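/- Let $n\ge 0$ be an integer and $\lambda,\delta>0$ real. On $\mathbb C^{n+1}$ (coordinates $z_j=x_j+iy_j$) let $\omega=\sum_j dx_j\wedge dy_j$, and let $W=\{z\in\mathbb C^{n+1}:\sum_{j=1}^{n+1} z_j^2=0\}$ be the node. Let $Q=Q_{n-1}\subset\mathbb P^n$ be the quadric of all lines contained in $W$, and let $$\mathcal L=\{(\ell,z)\in\mathbb P^n\times\mathbb C^{n+1}:\ \ell\in Q,\ z\in\ell\}$$ be the resolution of $W$ obtained by blowing up the origin, with projections $p:\mathcal L\to Q$ and $\pi:\mathcal L\to\mathbb C^{n+1}$, and with exceptional divisor the zero section $\{z=0\}\cong Q$. Let $\omega_Q$ be the restriction to $Q$ of the Fubini--Study form on $\mathbb P^n$, normalised so that its pull-back to the unit sphere $S^{2n+1}$ under the Hopf map is $\omega|_{S^{2n+1}}$, and put $\rho_\lambda=\pi^*\omega+\lambda^2p^*\omega_Q$. Let $B(r)=\{|z|<r\}$ and $\overline B(r)=\{|z|\le r\}$ in $\mathbb C^{n+1}$. Then $\pi^{-1}(B(\delta))\setminus Q$ with the form $\rho_\lambda$, and the shell $\big(B(\sqrt{\lambda^2+\delta^2})\setminus\overline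 B(\lambda)\big)\cap W$ with the form $\omega$, are symplectic manifolds of real dimension $2n$ (embedded in $\mathbb P^n\times\mathbb C^{n+1}$ and in $\mathbb C^{n+1}$ respectively), and the map $$F\circ\pi,\qquad F(z)=\frac{\sqrt{|z|^2+\lambda^2}}{|z|}\,z,$$ is a symplectomorphism from the first onto the second. The same map is a symplectomorphism (a diffeomorphism preserving the forms) from $\pi^{-1}(\overline B(\delta))\setminus Q$ onto $\big(\overline B(\sqrt{\lambda^2+\delta^2})\setminus\overline B(\lambda)\big)\cap W$. -/

import Mathlib

open Set Filter
open scoped Manifold Topology ContDiff LinearAlgebra.Projectivization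

noncomputable section

/-- The Hermitian space `ℂ^{n+1}`. -/
abbrev CSpace (n : ℕ) : Type := EuclideanSpace ℂ (Fin (n + 1))

/-- The complex projective space `ℙ^n`, the space of complex lines in `ℂ^{n+1}`. -/
abbrev PSpace (n : ℕ) : Type := ℙ ℂ (CSpace n)

/-! ### Complex projective space as a manifold -/

/-- The quotient topology on `ℙ^n`. -/
instance PSpace.topologicalSpace (n : ℕ) : TopologicalSpace (PSpace n) :=
  inferInstanceAs (TopologicalSpace (Quotient (projectivizationSetoid ℂ (CSpace n))))

namespace PSpace

variable {n : ℕ}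

theorem isQuotientMap_mk' :
    Topology.IsQuotientMap (Projectivization.mk' ℂ : {v : CSpace n // v ≠ 0} → PSpace n) :=
  isQuotientMap_quotient_mk'

/-- The affine coordinates `z_j / z_i`, `j ≠ i`, of a line spanned by `z`. -/
def affineCoord (i : Fin (n + 1)) (l : PSpace n) : EuclideanSpace ℂ (Fin n) :=
  WithLp.toLp 2 fun j => l.rep (i.succAbove j) / l.rep i

/-- The vector with `1` in position `i` and the entries of `w` in the other positions. -/
def affineVec (i : Fin (n + 1)) (w : EuclideanSpace ℂ (Fin n)) : CSpace n :=
  WithLp.toLp 2 (i.insertNth (1 : ℂ) (fun j => w j))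

@[simp] theorem affineVec_self (i : Fin (n + 1)) (w : EuclideanSpace ℂ (Fin n)) :
    affineVec i w i = 1 := by simp [affineVec]

@[simp] theorem affineVec_succAbove (i : Fin (n + 1)) (w : EuclideanSpace ℂ (Fin n))
    (j : Fin n) : affineVec i w (i.succAbove j) = w j := by simp [affineVec]

theorem affineVec_ne_zero (i : Fin (n + 1)) (w : EuclideanSpace ℂ (Fin n)) :
    affineVec i w ≠ 0 := by
  intro h
  have := affineVec_self i w
  rw [h] at this
  simp at this

theorem rep_mk_ne_zero_iff (i : Fin (n + 1)) (v : CSpace n) (hv : v ≠ 0) :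
    (Projectivization.mk ℂ v hv).rep i ≠ 0 ↔ v i ≠ 0 := by
  obtain ⟨a, ha⟩ := Projectivization.exists_smul_eq_mk_rep ℂ v hv
  rw [← ha]
  simp [Units.smul_def]

theorem affineCoord_mk (i : Fin (n + 1)) (v : CSpace n) (hv : v ≠ 0) :
    affineCoord i (Projectivization.mk ℂ v hv) =
      WithLp.toLp 2 fun j => v (i.succAbove j) / v i := by
  obtain ⟨a, ha⟩ := Projectivization.exists_smul_eq_mk_rep ℂ v hv
  rw [affineCoord, ← ha]
  congr 1
  funext j
  simp [Units.smul_def, mul_div_mul_left]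

theorem isOpen_source (i : Fin (n + 1)) : IsOpen {l : PSpace n | l.rep i ≠ 0} := by
  rw [← isQuotientMap_mk'.isOpen_preimage]
  have : (Projectivization.mk' ℂ : {v : CSpace n // v ≠ 0} → PSpace n) ⁻¹'
      {l : PSpace n | l.rep i ≠ 0} = {v | v.1 i ≠ 0} := by
    ext v
    exact rep_mk_ne_zero_iff i v.1 v.2
  rw [this]
  exact isOpen_ne_fun (by fun_prop) continuous_const

theorem contDiff_affineVec (i : Fin (n + 1)) : ContDiff ℝ ∞ (affineVec i) := by
  rw [contDiff_piLp]
  intro k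
  refine Fin.succAboveCases i ?_ (fun j => ?_) k
  · simpa using contDiff_const
  · simp only [affineVec_succAbove]
    exact contDiff_piLp_apply (𝕜 := ℝ) 2

/-- The standard affine chart of `ℙ^n` on the set of lines on which `z_i` does not vanish. -/
def affineChart (i : Fin (n + 1)) :
    OpenPartialHomeomorph (PSpace n) (EuclideanSpace ℂ (Fin n)) where
  toFun := affineCoord i
  invFun w := Projectivization.mk ℂ (affineVec i w) (affineVec_ne_zero i w)
  source := {l | l.rep i ≠ 0}
  target := univ
  map_source' _ _ := mem_univ _
  map_target' w _ := by
    rw [mem_ofPred_eq, rep_mk_ne_zero_iff]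
    simp
  left_inv' l hl := by
    induction l using Projectivization.ind with
    | h v hv =>
      have hvi : v i ≠ 0 := (rep_mk_ne_zero_iff i v hv).1 hl
      rw [Projectivization.mk_eq_mk_iff']
      refine ⟨(v i)⁻¹, ?_⟩
      ext k
      rw [affineCoord_mk]
      refine Fin.succAboveCases i ?_ (fun j => ?_) k
      · simp [hvi]
      · simp [div_eq_inv_mul]
  right_inv' w _ := by
    rw [affineCoord_mk]
    ext j
    simp
  open_source := isOpen_source i
  open_target := isOpen_univ
  continuousOn_toFun := by
    rw [isQuotientMap_mk'.continuousOn_isOpen_iff (isOpen_source i)]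
    have h1 : (affineCoord i ∘ Projectivization.mk' ℂ : {v : CSpace n // v ≠ 0} → _) =
        fun v => WithLp.toLp 2 fun j => v.1 (i.succAbove j) / v.1 i := by
      funext v
      exact affineCoord_mk i v.1 v.2
    rw [h1]
    refine (PiLp.continuous_toLp 2 _).comp_continuousOn (continuousOn_pi.2 fun j => ?_)
    refine ContinuousOn.div (by fun_prop) (by fun_prop) fun v hv => ?_
    exact (rep_mk_ne_zero_iff i v.1 v.2).1 hv
  continuousOn_invFun := by
    refine Continuous.continuousOn ?_
    exact isQuotientMap_mk'.continuous.comp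
      (Continuous.subtype_mk (contDiff_affineVec i).continuous (affineVec_ne_zero i))

theorem exists_rep_ne_zero (l : PSpace n) : ∃ i, l.rep i ≠ 0 := by
  by_contra! h
  exact l.rep_nonzero (PiLp.ext h)

/-- The index of the preferred affine chart at a line. -/
def chartIndex (l : PSpace n) : Fin (n + 1) := (exists_rep_ne_zero l).choose

theorem chartIndex_spec (l : PSpace n) : l.rep (chartIndex l) ≠ 0 :=
  (exists_rep_ne_zero l).choose_spec

end PSpace

/-- `ℙ^n` with its atlas of standard affine charts. -/
instance PSpace.chartedSpace (n : ℕ) : ChartedSpace (EuclideanSpace ℂ (Fin n)) (PSpace n) where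
  atlas := range PSpace.affineChart
  chartAt l := PSpace.affineChart (PSpace.chartIndex l)
  mem_chart_source := PSpace.chartIndex_spec
  chart_mem_atlas _ := mem_range_self _

instance PSpace.isManifold (n : ℕ) :
    IsManifold 𝓘(ℝ, EuclideanSpace ℂ (Fin n)) ∞ (PSpace n) := by
  apply isManifold_of_contDiffOn
  rintro _ _ ⟨i, rfl⟩ ⟨k, rfl⟩
  simp only [modelWithCornersSelf_coe, modelWithCornersSelf_coe_symm, Function.id_comp,
    Function.comp_id, range_id, inter_univ, preimage_id]
  have h1 : ∀ w, ((PSpace.affineChart i).symm ≫ₕ PSpace.affineChart k) w =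
      WithLp.toLp 2 fun j => PSpace.affineVec i w (k.succAbove j) / PSpace.affineVec i w k :=
    fun w => PSpace.affineCoord_mk k _ (PSpace.affineVec_ne_zero i w)
  refine ContDiffOn.congr ?_ fun w _ => h1 w
  rw [contDiffOn_piLp]
  intro j
  have h2 := (contDiff_piLp 2).1 (PSpace.contDiff_affineVec i)
  simp only [div_eq_mul_inv]
  refine (h2 (k.succAbove j)).contDiffOn.mul ((h2 k).contDiffOn.inv fun w hw => ?_)
  have h3 : (Projectivization.mk ℂ (PSpace.affineVec i w)
      (PSpace.affineVec_ne_zero i w)).rep k ≠ 0 := hw.2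
  exact (PSpace.rep_mk_ne_zero_iff k _ _).1 h3


/-! ### Two-forms and symplectomorphisms -/

section Forms

variable {E : Type*} [NormedAddCommGroup E] [NormedSpace ℝ E] {H : Type*} [TopologicalSpace H]
  {E' : Type*} [NormedAddCommGroup E'] [NormedSpace ℝ E'] {H' : Type*} [TopologicalSpace H']

/-- A (not necessarily continuous) field of alternating bilinear forms on a manifold `M`. -/
abbrev TwoForm (I : ModelWithCorners ℝ E H) (M : Type*) [TopologicalSpace M]
    [ChartedSpace H M] : Type _ :=
  ∀ x : M, TangentSpace I x [⋀^Fin 2]→L[ℝ] ℝ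

variable (I : ModelWithCorners ℝ E H) {M : Type*} [TopologicalSpace M] [ChartedSpace H M]
  (J : ModelWithCorners ℝ E' H') {N : Type*} [TopologicalSpace N] [ChartedSpace H' N]

/-- The pull-back `f^* α`. -/
def TwoForm.pullback (f : M → N) (α : TwoForm J N) : TwoForm I M := fun x =>
  (α (f x)).compContinuousLinearMap (mfderiv I J f x)

/-- The vectors tangent to a subset `S` of `M` at `x`: the initial velocities of smooth curves
`[0, ∞) → S` starting at `x`. If `S` is an embedded submanifold, this is its tangent space (if `S`
has a boundary and `x` is on it, the half-space of inward-pointing tangent vectors). -/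
def tangentVectors (S : Set M) (x : M) : Set (TangentSpace I x) :=
  {v | ∃ c : ℝ → M, ContMDiffOn 𝓘(ℝ, ℝ) I ∞ c (Ici 0) ∧ MapsTo c (Ici 0) S ∧ c 0 = x ∧
    (mfderivWithin 𝓘(ℝ, ℝ) I c (Ici 0) 0 (1 : ℝ) : E) = v}

/-- `f` restricts to a diffeomorphism from the subset `S` of `M` onto the subset `T` of `N`. -/
structure IsDiffeoOn (S : Set M) (T : Set N) (f : M → N) : Prop where
  bijOn : BijOn f S T
  smooth : ContMDiffOn I J ∞ f S
  smooth_inv : ∃ g : N → M, InvOn g f S T ∧ ContMDiffOn J I ∞ g T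

/-- `S` is an embedded `d`-dimensional submanifold of `M` without boundary: it is locally
diffeomorphic to open subsets of `ℝ^d`. -/
def IsSmoothSubmanifold (S : Set M) (d : ℕ) : Prop :=
  ∀ x ∈ S, ∃ (U : Set M) (O : Set (EuclideanSpace ℝ (Fin d))) (φ : EuclideanSpace ℝ (Fin d) → M),
    IsOpen U ∧ x ∈ U ∧ IsOpen O ∧ IsDiffeoOn 𝓘(ℝ, EuclideanSpace ℝ (Fin d)) I O (S ∩ U) φ

/-- The restriction of `α` to `S` is a smooth closed form: its pull-back under every smooth map
from an open subset of some `ℝ^k` to `S` is smooth and has vanishing exterior derivative. -/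
def IsSmoothClosedOn (S : Set M) (α : TwoForm I M) : Prop :=
  ∀ (k : ℕ) (O : Set (EuclideanSpace ℝ (Fin k))) (φ : EuclideanSpace ℝ (Fin k) → M),
    IsOpen O → ContMDiffOn 𝓘(ℝ, EuclideanSpace ℝ (Fin k)) I ∞ φ O → MapsTo φ O S →
    let β : EuclideanSpace ℝ (Fin k) → EuclideanSpace ℝ (Fin k) [⋀^Fin 2]→L[ℝ] ℝ :=
      TwoForm.pullback 𝓘(ℝ, EuclideanSpace ℝ (Fin k)) I φ α
    ContDiffOn ℝ ∞ β O ∧ ∀ y ∈ O, extDeriv β y = 0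

/-- `S` is an embedded `d`-dimensional submanifold of `M` on which `α` restricts to a symplectic
form, i.e. to a smooth closed nondegenerate 2-form. -/
structure IsSymplecticSubmanifold (S : Set M) (d : ℕ) (α : TwoForm I M) : Prop where
  submanifold : IsSmoothSubmanifold I S d
  smooth_closed : IsSmoothClosedOn I S α
  nondegenerate : ∀ x ∈ S, ∀ u ∈ tangentVectors I S x, u ≠ 0 →
    ∃ v ∈ tangentVectors I S x, α x ![u, v] ≠ 0

/-- `f` restricts to a diffeomorphism from `S ⊆ M` onto `T ⊆ N` which pulls back the restriction
of `β` to `T` to the restriction of `α` to `S`. (On tangent vectors of `S` all derivatives of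
`f` within `S` agree, so the choice made by `mfderivWithin` does not matter.) -/
structure IsSymplectomorphismOn (S : Set M) (α : TwoForm I M) (T : Set N) (β : TwoForm J N)
    (f : M → N) : Prop where
  diffeo : IsDiffeoOn I J S T f
  pullback_eq : ∀ x ∈ S, ∀ u ∈ tangentVectors I S x, ∀ v ∈ tangentVectors I S x,
    β (f x) ![mfderivWithin I J f S x u, mfderivWithin I J f S x v] = α x ![u, v]

end Forms

/-! ### The standard form and the Fubini-Study form -/

/-- The alternating form `∑ dx_j ∧ dy_j` on `ℂ^{n+1}`, where `z_j = x_j + i y_j`. -/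
def stdAlt (n : ℕ) : CSpace n [⋀^Fin 2]→L[ℝ] ℝ where
  toFun m := ∑ j, ((m 0 j).re * (m 1 j).im - (m 1 j).re * (m 0 j).im)
  map_update_add' m i x y := by
    rw [← Finset.sum_add_distrib]
    refine Finset.sum_congr rfl fun j _ => ?_
    fin_cases i <;> simp [Function.update] <;> ring
  map_update_smul' m i c x := by
    rw [smul_eq_mul, Finset.mul_sum]
    refine Finset.sum_congr rfl fun j _ => ?_
    fin_cases i <;> simp [Function.update] <;> ring
  map_eq_zero_of_eq' m i k h hik := by
    have : m 0 = m 1 := by fin_cases i <;> fin_cases k <;> simp_all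
    simp [this]
  cont := by fun_prop

/-- The standard symplectic form `ω = ∑ dx_j ∧ dy_j` on `ℂ^{n+1}`. -/
def stdForm (n : ℕ) : TwoForm 𝓘(ℝ, CSpace n) (CSpace n) := fun _ => stdAlt n

/-- Over the set of lines `[z]` with `z_i ≠ 0`, the section of the Hopf map `S^{2n+1} → ℙ^n` which
sends a line to its unit vector with positive `i`-th coordinate. -/
def hopfSection {n : ℕ} (i : Fin (n + 1)) (l : PSpace n) : CSpace n :=
  (star (l.rep i) / (‖l.rep i‖ * ‖l.rep‖ : ℝ)) • l.rep

/-- The Fubini-Study form, i.e. the form whose pull-back to the unit sphere under the Hopf map is the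
restriction of the standard form. Near `l` it is the pull-back of the standard form under any
local section of the Hopf map. -/
def fubiniStudy (n : ℕ) : TwoForm 𝓘(ℝ, EuclideanSpace ℂ (Fin n)) (PSpace n) := fun l =>
  TwoForm.pullback 𝓘(ℝ, EuclideanSpace ℂ (Fin n)) 𝓘(ℝ, CSpace n)
    (hopfSection (PSpace.chartIndex l)) (stdForm n) l

/-! ### The node and its resolution -/

/-- The node `W = {∑ z_i ^ 2 = 0}`. -/
def node (n : ℕ) : Set (CSpace n) := {z | ∑ i, z i ^ 2 = 0}

/-- The quadric `Q_{n-1}` in `ℙ^n`. -/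
def quadric (n : ℕ) : Set (PSpace n) := {l | ∀ z ∈ l.submodule, ∑ i, z i ^ 2 = 0}

/-- The model with corners of the real manifold `ℙ^n × ℂ^{n+1}`. -/
abbrev ambientModel (n : ℕ) := 𝓘(ℝ, EuclideanSpace ℂ (Fin n)).prod 𝓘(ℝ, CSpace n)

/-- The resolution of the node: the total space of the restriction to `Q_{n-1}` of the
tautological line bundle `{(l, z) | z ∈ l} ⊆ ℙ^n × ℂ^{n+1}`, which is the normal bundle of the
exceptional divisor. -/
def resolution (n : ℕ) : Set (PSpace n × CSpace n) :=
  {x | x.1 ∈ quadric n ∧ x.2 ∈ x.1.submodule}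

/-- The exceptional divisor, a copy of `Q_{n-1}`: the zero section of the resolution. -/
def exceptionalDivisor (n : ℕ) : Set (PSpace n × CSpace n) := {x ∈ resolution n | x.2 = 0}

/-- The projection `p` to `ℙ^n`, mapping the resolution to `Q_{n-1}`. -/
def projP (n : ℕ) : PSpace n × CSpace n → PSpace n := Prod.fst

/-- The projection `π` to `ℂ^{n+1}`, mapping the resolution to the node. -/
def projC (n : ℕ) : PSpace n × CSpace n → CSpace n := Prod.snd

/-- The form `ρ_λ = π^* ω + λ ^ 2 p^* ω_Q` on the resolution, as the restriction of a form on
`ℙ^n × ℂ^{n+1}`. -/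
def rho (n : ℕ) (lam : ℝ) : TwoForm (ambientModel n) (PSpace n × CSpace n) := fun x =>
  TwoForm.pullback (ambientModel n) 𝓘(ℝ, CSpace n) (projC n) (stdForm n) x +
    lam ^ 2 • TwoForm.pullback (ambientModel n) 𝓘(ℝ, EuclideanSpace ℂ (Fin n))
      (projP n) (fubiniStudy n) x

/-- The radial map `z ↦ (√(|z|^2 + λ^2) / |z|) z`. -/
def radialMap (n : ℕ) (lam : ℝ) (z : CSpace n) : CSpace n :=
  (Real.sqrt (‖z‖ ^ 2 + lam ^ 2) / ‖z‖) • z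

end

/-! Everything rests on one identity on `ℂ^{n+1} \ {0}`, with no reference to the node. Both the
radial map `F` and the local Hopf normalisation `θ(z) = hopfFactor i z • z`, which moves `z` to a
unit vector in its own line, have the form `z ↦ h(z) z` with `|h(z) z|² = ε|z|² + c`. For such maps
`stdAlt_rescaling` computes the pull-back of `ω` from `ε`, `|h|` and `dh`. Write `X` for the form
with value `Re⟨z,a⟩ Im⟨z,b⟩ - Re⟨z,b⟩ Im⟨z,a⟩` on `(a, b)`. For `F` (`ε = 1`, `c = λ²`, `h` real)
the result is `(1 + λ²/|z|²) ω - (λ²/|z|⁴) X`; for `θ` (`ε = 0`, `c = 1`) it is `ω/|z|² - X/|z|⁴`.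
Hence `F^*ω = ω + λ² θ^*ω` (`stdAlt_fderiv_radialMap`).

Off the zero section of the resolution, `θ ∘ π` is a section of the Hopf map composed with `p`, so
`π^*θ^*ω = p^*ω_Q` on tangent vectors and `ρ_λ = (F ∘ π)^*ω`. The inverse of `F ∘ π` is `w ↦ ([w],
radialInv w)`, smooth where `|w| > λ`.

The node without the origin is locally the graph of a square root. Its tangent spaces are complex,
so `ω(u, iu) = |u|²` makes `ω` nondegenerate there. The symplectic structure of the shell is then
carried back to the resolution along `F ∘ π`. -/

noncomputable section

/-! ### Tangent vectors as velocities of one-sided curves -/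

section TangentVectors

variable {E : Type*} [NormedAddCommGroup E] [NormedSpace ℝ E] {H : Type*} [TopologicalSpace H]
  {E' : Type*} [NormedAddCommGroup E'] [NormedSpace ℝ E'] {H' : Type*} [TopologicalSpace H']
  {V : Type*} [NormedAddCommGroup V] [NormedSpace ℝ V]
  {I : ModelWithCorners ℝ E H} {M : Type*} [TopologicalSpace M] [ChartedSpace H M]
  {J : ModelWithCorners ℝ E' H'} {N : Type*} [TopologicalSpace N] [ChartedSpace H' N]
  {S : Set M} {T : Set N} {f : M → N} {x : M}

/-- Derivatives within the half-line are unique, whereas those within a subset of positive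
codimension in general are not. Derivatives within `S` are therefore compared along curves. -/
theorem uniqueMDiffWithinAt_Ici_zero : UniqueMDiffWithinAt 𝓘(ℝ, ℝ) (Ici (0 : ℝ)) 0 :=
  (uniqueDiffWithinAt_Ici 0).uniqueMDiffWithinAt

/-- Every derivative of `f` within `S` maps the velocity of a curve `c` in `S` to that of
`f ∘ c`. -/
theorem HasMFDerivWithinAt.apply_velocity {c : ℝ → M}
    (hc : ContMDiffOn 𝓘(ℝ, ℝ) I ∞ c (Ici 0)) (hcS : MapsTo c (Ici 0) S) (hcx : c 0 = x)
    {f' : TangentSpace I x →L[ℝ] TangentSpace J (f x)} (hf : HasMFDerivWithinAt I J f S x f') :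
    (mfderivWithin 𝓘(ℝ, ℝ) J (f ∘ c) (Ici 0) 0 (1 : ℝ) : E') =
      f' (mfderivWithin 𝓘(ℝ, ℝ) I c (Ici 0) 0 (1 : ℝ) : E) := by
  subst hcx
  have h1 := ((hc 0 self_mem_Ici).mdifferentiableWithinAt (by simp)).hasMFDerivWithinAt
  rw [(hf.comp 0 h1 hcS).mfderivWithin uniqueMDiffWithinAt_Ici_zero]
  rfl

/-- All derivatives of `f` within `S` agree on the vectors tangent to `S`. -/
theorem HasMFDerivWithinAt.apply_eq_of_mem_tangentVectors
    {f₁ f₂ : TangentSpace I x →L[ℝ] TangentSpace J (f x)}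
    (h₁ : HasMFDerivWithinAt I J f S x f₁) (h₂ : HasMFDerivWithinAt I J f S x f₂)
    {u : TangentSpace I x} (hu : u ∈ tangentVectors I S x) : f₁ u = f₂ u := by
  obtain ⟨c, hc, hcS, hcx, rfl⟩ := hu
  exact (h₁.apply_velocity hc hcS hcx).symm.trans (h₂.apply_velocity hc hcS hcx)

/-- If `f = g` on `S`, all derivatives of `f` and of `g` within `S` agree on the vectors tangent
to `S`. -/
theorem HasMFDerivWithinAt.apply_eq_of_eqOn {g : M → N} {f' g' : E →L[ℝ] E'}
    (hf : HasMFDerivWithinAt I J f S x f') (hg : HasMFDerivWithinAt I J g S x g')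
    (hfg : EqOn f g S) (hx : x ∈ S) {u : E} (hu : u ∈ tangentVectors I S x) : f' u = g' u :=
  (hf.congr_of_eventuallyEq (hfg.symm.eventuallyEq_of_mem self_mem_nhdsWithin)
    (hfg hx).symm).apply_eq_of_mem_tangentVectors hg hu

theorem mfderivWithin_mem_tangentVectors (hf : ContMDiffOn I J ∞ f S) (hST : MapsTo f S T)
    (hx : x ∈ S) {u : TangentSpace I x} (hu : u ∈ tangentVectors I S x) :
    mfderivWithin I J f S x u ∈ tangentVectors J T (f x) := by
  obtain ⟨c, hc, hcS, hcx, rfl⟩ := hu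
  refine ⟨f ∘ c, hf.comp hc hcS, hST.comp hcS, congrArg f hcx, ?_⟩
  have h2 := ((hf _ hx).mdifferentiableWithinAt (by simp)).hasMFDerivWithinAt
  exact h2.apply_velocity hc hcS hcx

/-- If `w` is the velocity of a curve `c` in `T`, the velocity of `g ∘ c` is a preimage, because `f
∘ g ∘ c = c` on the half-line. -/
theorem IsDiffeoOn.exists_mfderivWithin_eq (hf : IsDiffeoOn I J S T f) (hx : x ∈ S)
    {w : TangentSpace J (f x)} (hw : w ∈ tangentVectors J T (f x)) :
    ∃ v ∈ tangentVectors I S x, mfderivWithin I J f S x v = w := by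
  obtain ⟨g, hgf, hg⟩ := hf.smooth_inv
  have hgT : MapsTo g T S := hgf.1.mapsTo hf.bijOn.surjOn
  obtain ⟨c, hc, hcT, hcx, rfl⟩ := hw
  have hgc : ContMDiffOn 𝓘(ℝ, ℝ) I ∞ (g ∘ c) (Ici 0) := hg.comp hc hcT
  have hgcx : (g ∘ c) 0 = x := by rw [Function.comp_apply, hcx, hgf.1 hx]
  refine ⟨_, ⟨g ∘ c, hgc, hgT.comp hcT, hgcx, rfl⟩, ?_⟩
  have h1 := ((hf.smooth _ hx).mdifferentiableWithinAt (by simp)).hasMFDerivWithinAt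
  refine (h1.apply_velocity hgc (hgT.comp hcT) hgcx).symm.trans ?_
  have h2 : EqOn (f ∘ g ∘ c) c (Ici 0) := fun t ht => hgf.2 (hcT ht)
  have h3 := ((hc 0 self_mem_Ici).mdifferentiableWithinAt (by simp)).hasMFDerivWithinAt
  rw [(h3.congr_of_eventuallyEq (h2.eventuallyEq_of_mem self_mem_nhdsWithin)
    (h2 self_mem_Ici)).mfderivWithin uniqueMDiffWithinAt_Ici_zero]
  rfl

/-- The line segments through `y` provide all tangent vectors of an open set. -/
theorem mem_tangentVectors_of_isOpen {O : Set V} (hO : IsOpen O) {y : V} (hy : y ∈ O)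
    (w : V) : w ∈ tangentVectors 𝓘(ℝ, V) O y := by
  obtain ⟨ε, hε, hεO⟩ : ∃ ε > 0, ∀ t ∈ Icc (0 : ℝ) ε, y + t • w ∈ O := by
    have h1 : Tendsto (fun t : ℝ => y + t • w) (𝓝 0) (𝓝 y) := by
      have : Continuous fun t : ℝ => y + t • w := by fun_prop
      simpa using this.tendsto 0
    obtain ⟨ε, hε, h⟩ := Metric.eventually_nhds_iff.1 (h1.eventually (hO.mem_nhds hy))
    refine ⟨ε / 2, half_pos hε, fun t ht => h ?_⟩
    rw [Real.dist_eq, sub_zero, abs_of_nonneg ht.1]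
    linarith [ht.2]
  have hne : ∀ t ∈ Ici (0 : ℝ), ε + t ≠ 0 := fun t ht => by
    have : (0 : ℝ) ≤ t := ht
    positivity
  -- The curve has to stay in `O` for all `t ≥ 0`. The function `ε t / (ε + t)` maps `[0, ∞)` into
  -- `[0, ε)` and has derivative `1` at `0`.
  refine ⟨fun t => y + (ε * t / (ε + t)) • w, ?_, ?_, by simp, ?_⟩
  · rw [contMDiffOn_iff_contDiffOn]
    refine contDiffOn_const.add (ContDiffOn.smul ?_ contDiffOn_const)
    exact (contDiffOn_const.mul contDiffOn_id).div (contDiffOn_const.add contDiffOn_id) hne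
  · intro t ht
    have h0 : (0 : ℝ) ≤ t := ht
    refine hεO _ ⟨by positivity, ?_⟩
    rw [div_le_iff₀ (by positivity)]
    nlinarith
  · have h1 : HasDerivAt (fun t : ℝ => ε * t / (ε + t)) 1 0 := by
      have := ((hasDerivAt_id (0 : ℝ)).const_mul ε).div ((hasDerivAt_id (0 : ℝ)).const_add ε)
        (by simpa using hε.ne')
      refine this.congr_deriv ?_
      simp only [id, mul_one, add_zero, mul_zero, sub_zero]
      field_simp
    have h2 := ((h1.smul_const (w : V)).const_add y).hasDerivWithinAt (s := Ici 0)
    have h3 : HasMFDerivWithinAt 𝓘(ℝ, ℝ) 𝓘(ℝ, V)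
      (fun t : ℝ => y + (ε * t / (ε + t)) • w) (Ici 0) 0 _ :=
      h2.hasFDerivWithinAt.hasMFDerivWithinAt
    rw [h3.mfderivWithin uniqueMDiffWithinAt_Ici_zero]
    change ((1 : ℝ) • ((1 : ℝ) • w)) = w
    simp

/-- The derivative of a smooth map from an open set to `S` takes values in the vectors tangent
to `S`. -/
theorem mfderiv_mem_tangentVectors {O : Set V} (hO : IsOpen O) {φ : V → M}
    (hφ : ContMDiffOn 𝓘(ℝ, V) I ∞ φ O) (hφS : MapsTo φ O S) {y : V} (hy : y ∈ O)
    (w : TangentSpace 𝓘(ℝ, V) y) : mfderiv 𝓘(ℝ, V) I φ y w ∈ tangentVectors I S (φ y) := by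
  have := mfderivWithin_mem_tangentVectors hφ hφS hy (mem_tangentVectors_of_isOpen hO hy w)
  rwa [mfderivWithin_of_isOpen hO hy] at this

/-! ### Transport of symplectic structures -/

theorem IsDiffeoOn.isSmoothSubmanifold {d : ℕ} (hf : IsDiffeoOn I J S T f)
    (hT : IsSmoothSubmanifold J T d) : IsSmoothSubmanifold I S d := by
  intro x hx
  obtain ⟨g, hgf, hg⟩ := hf.smooth_inv
  obtain ⟨U, O, φ, hU, hxU, hO, hφ⟩ := hT (f x) (hf.bijOn.mapsTo hx)
  obtain ⟨ψ, hψφ, hψ⟩ := hφ.smooth_inv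
  -- Since `f` is continuous only on `S`, `f ⁻¹' U` need not be open; it is replaced by an open `U'`
  -- with the same trace on `S`.
  obtain ⟨U', hU', hUU'⟩ := (continuousOn_iff'.1 hf.smooth.continuousOn) U hU
  have hSU : S ∩ U' = S ∩ f ⁻¹' U := by rw [inter_comm S U', ← hUU', inter_comm]
  have hgS : BijOn g (T ∩ U) (S ∩ U') := by
    refine ⟨fun z hz => ?_, (LeftInvOn.injOn hgf.2).mono inter_subset_left, fun z hz => ?_⟩
    · rw [hSU]
      have hzS : g z ∈ S := hgf.1.mapsTo hf.bijOn.surjOn hz.1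
      refine ⟨hzS, ?_⟩
      rw [mem_preimage, hgf.2 hz.1]
      exact hz.2
    · rw [hSU] at hz
      exact ⟨f z, ⟨hf.bijOn.mapsTo hz.1, hz.2⟩, hgf.1 hz.1⟩
  have hfTU : MapsTo f (S ∩ U') (T ∩ U) := fun z hz => by
    rw [hSU] at hz
    exact ⟨hf.bijOn.mapsTo hz.1, hz.2⟩
  refine ⟨U', O, g ∘ φ, hU', ?_, hO, ⟨hgS.comp hφ.bijOn, ?_, ψ ∘ f, ⟨?_, ?_⟩, ?_⟩⟩
  · have : x ∈ S ∩ U' := hSU ▸ ⟨hx, hxU⟩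
    exact this.2
  · exact hg.comp hφ.smooth fun y hy => (hφ.bijOn.mapsTo hy).1
  · intro y hy
    have := hφ.bijOn.mapsTo hy
    simp only [Function.comp_apply, hgf.2 this.1, hψφ.1 hy]
  · intro z hz
    simp only [Function.comp_apply, hψφ.2 (hfTU hz), hgf.1 hz.1]
  · exact hψ.comp (hf.smooth.mono inter_subset_left) hfTU

/-- For a test map `φ` into `S`, the derivative of `φ` takes values in tangent vectors of `S`, so
`φ^*α = (f ∘ φ)^*β` on the open set `O`, and `f ∘ φ` is a test map into `T`. -/
theorem IsSymplectomorphismOn.isSmoothClosedOn {α : TwoForm I M} {β : TwoForm J N}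
    (hf : IsSymplectomorphismOn I J S α T β f) (hβ : IsSmoothClosedOn J T β) :
    IsSmoothClosedOn I S α := by
  intro k O φ hO hφ hφS
  obtain ⟨h1, h2⟩ := hβ k O (f ∘ φ) hO (hf.diffeo.smooth.comp hφ hφS)
    (hf.diffeo.bijOn.mapsTo.comp hφS)
  let P := EuclideanSpace ℝ (Fin k)
  have key : EqOn (show P → P [⋀^Fin 2]→L[ℝ] ℝ from TwoForm.pullback 𝓘(ℝ, P) I φ α)
      (show P → P [⋀^Fin 2]→L[ℝ] ℝ from TwoForm.pullback 𝓘(ℝ, P) J (f ∘ φ) β) O := by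
    intro y hy
    have h3 : HasMFDerivAt 𝓘(ℝ, EuclideanSpace ℝ (Fin k)) I φ y _ :=
      ((hφ.contMDiffAt (hO.mem_nhds hy)).mdifferentiableAt (by simp)).hasMFDerivAt
    have h4 := ((hf.diffeo.smooth _ (hφS hy)).mdifferentiableWithinAt (by simp)).hasMFDerivWithinAt
    have h5 := (h4.comp y h3.hasMFDerivWithinAt hφS).hasMFDerivAt (hO.mem_nhds hy)
    ext m
    have h6 := hf.pullback_eq _ (hφS hy) _ (mfderiv_mem_tangentVectors hO hφ hφS hy (m 0))
      _ (mfderiv_mem_tangentVectors hO hφ hφS hy (m 1))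
    change α (φ y) (fun i => mfderiv 𝓘(ℝ, P) I φ y (m i)) =
      β (f (φ y)) (fun i => mfderiv 𝓘(ℝ, P) J (f ∘ φ) y (m i))
    rw [h5.mfderiv]
    refine Eq.trans ?_ (h6.symm.trans ?_)
    · congr 1
      ext i
      fin_cases i <;> rfl
    · congr 1
      ext i
      fin_cases i <;> rfl
  exact ⟨h1.congr key, fun y hy => (Filter.EventuallyEq.extDeriv_eq
    (key.eventuallyEq_of_mem (hO.mem_nhds hy))).trans (h2 y hy)⟩

/-- The derivative of `f` is injective on tangent vectors because `g ∘ f = id` on `S`, and every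
tangent vector of `T` at `f x` lifts to `S`. -/
theorem IsSymplectomorphismOn.nondegenerate {α : TwoForm I M} {β : TwoForm J N}
    (hf : IsSymplectomorphismOn I J S α T β f)
    (hβ : ∀ z ∈ T, ∀ u ∈ tangentVectors J T z, u ≠ 0 → ∃ v ∈ tangentVectors J T z, β z ![u, v] ≠ 0)
    (hx : x ∈ S) {u : TangentSpace I x} (hu : u ∈ tangentVectors I S x) (hu0 : u ≠ 0) :
    ∃ v ∈ tangentVectors I S x, α x ![u, v] ≠ 0 := by
  obtain ⟨g, hgf, hg⟩ := hf.diffeo.smooth_inv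
  have hfS := hf.diffeo.bijOn.mapsTo
  have hfx := ((hf.diffeo.smooth _ hx).mdifferentiableWithinAt (by simp)).hasMFDerivWithinAt
  have hgx := ((hg _ (hfS hx)).mdifferentiableWithinAt (by simp)).hasMFDerivWithinAt
  have h0 : mfderivWithin I J f S x u ≠ 0 := by
    intro h0
    have h1 : HasMFDerivWithinAt I I (g ∘ f) S x _ := hgx.comp x hfx hfS
    have h2 : HasMFDerivWithinAt I I id S x (ContinuousLinearMap.id ℝ _) :=
      hasMFDerivWithinAt_id S x
    apply hu0
    refine (h1.apply_eq_of_eqOn h2 hgf.1 hx hu).symm.trans ?_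
    change mfderivWithin J I g T (f x) (mfderivWithin I J f S x u) = 0
    rw [h0, map_zero]
  obtain ⟨w, hw, hw0⟩ := hβ _ (hfS hx) _
    (mfderivWithin_mem_tangentVectors hf.diffeo.smooth hfS hx hu) h0
  obtain ⟨v, hv, rfl⟩ := hf.diffeo.exists_mfderivWithin_eq hx hw
  exact ⟨v, hv, by rwa [hf.pullback_eq x hx u hu v hv] at hw0⟩

theorem IsSymplectomorphismOn.isSymplecticSubmanifold {d : ℕ} {α : TwoForm I M} {β : TwoForm J N}
    (hf : IsSymplectomorphismOn I J S α T β f) (hT : IsSymplecticSubmanifold J T d β) :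
    IsSymplecticSubmanifold I S d α :=
  ⟨hf.diffeo.isSmoothSubmanifold hT.submanifold, hf.isSmoothClosedOn hT.smooth_closed,
    fun _ hx _ hu hu0 => hf.nondegenerate hT.nondegenerate hx hu hu0⟩

end TangentVectors

/-! ### Constant forms -/

section ConstantForms

variable {E : Type*} [NormedAddCommGroup E] [NormedSpace ℝ E]
  {F : Type*} [NormedAddCommGroup F] [NormedSpace ℝ F]

open ContinuousAlternatingMap in
/-- The pull-back of an alternating bilinear form depends smoothly on the linear map. -/
theorem contDiff_compContinuousLinearMap (α : F [⋀^Fin 2]→L[ℝ] ℝ) :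
    ContDiff ℝ ∞ fun L : E →L[ℝ] F => α.compContinuousLinearMap L := by
  let A : (E →L[ℝ] E [⋀^Fin 1]→L[ℝ] ℝ) →L[ℝ] E [⋀^Fin 2]→L[ℝ] ℝ := alternatizeUncurryFinCLM ℝ E ℝ
  let eE := (ofSubsingletonLIE (𝕜 := ℝ) (E := E) (F := ℝ) (0 : Fin 1)).toContinuousLinearEquiv
  let eF := (ofSubsingletonLIE (𝕜 := ℝ) (E := F) (F := ℝ) (0 : Fin 1)).toContinuousLinearEquiv
  let B : F →L[ℝ] F →L[ℝ] ℝ := (eF.symm : _ →L[ℝ] (F →L[ℝ] ℝ)) ∘L α.curryLeft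
  -- The map `A` antisymmetrises `(x, y) ↦ α (L x, L y)` without normalising. This form is already
  -- alternating, so it gets doubled; hence the factor `1/2`. The right-hand side is built from
  -- continuous linear maps and compositions, so it is smooth in `L`.
  have h : (fun L : E →L[ℝ] F => α.compContinuousLinearMap L) = fun L =>
      (2⁻¹ : ℝ) • A ((eE : (E →L[ℝ] ℝ) →L[ℝ] _) ∘L
        (((ContinuousLinearMap.compL ℝ E F ℝ).flip L) ∘L (B ∘L L))) := by
    funext L
    ext m
    have h2 : ∀ x y : E, eE ((B (L x)).comp L) ![y] = α ![L x, L y] := by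
      intro x y
      change α (Matrix.vecCons (L x) (fun _ => L y)) = _
      congr 1
      ext i
      fin_cases i <;> rfl
    have h3 : α ![L (m 1), L (m 0)] = - α ![L (m 0), L (m 1)] := by
      refine Eq.trans ?_ (α.toAlternatingMap.map_swap ![L (m 0), L (m 1)]
        (show (0 : Fin 2) ≠ 1 by decide))
      change α _ = α _
      congr 1
      ext i
      fin_cases i <;> rfl
    have h4 : A ((eE : (E →L[ℝ] ℝ) →L[ℝ] _) ∘L
        (((ContinuousLinearMap.compL ℝ E F ℝ).flip L) ∘L (B ∘L L))) m =
        eE ((B (L (m 0))).comp L) ![m 1] - eE ((B (L (m 1))).comp L) ![m 0] := by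
      change alternatizeUncurryFin _ m = _
      rw [alternatizeUncurryFin_apply, Fin.sum_univ_two]
      simp only [Fin.val_zero, pow_zero, one_smul, Fin.val_one, pow_one, neg_smul, ← sub_eq_add_neg]
      congr 1
    rw [ContinuousAlternatingMap.smul_apply, h4, h2, h2, h3]
    change α (fun i => L (m i)) = _
    have h5 : (fun i => L (m i)) = ![L (m 0), L (m 1)] := by
      ext i
      fin_cases i <;> rfl
    rw [h5, smul_eq_mul]
    ring
  have hA : ContDiff ℝ ∞ A := ContinuousLinearMap.contDiff (𝕜 := ℝ)
    (E := E →L[ℝ] E [⋀^Fin 1]→L[ℝ] ℝ) (F := E [⋀^Fin 2]→L[ℝ] ℝ) A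
  rw [h]
  refine ContDiff.const_smul _ (hA.comp ?_)
  refine contDiff_const.clm_comp (ContDiff.clm_comp ?_ (contDiff_const.clm_comp contDiff_id))
  exact ContinuousLinearMap.contDiff (𝕜 := ℝ) (E := E →L[ℝ] F)
    (F := (F →L[ℝ] ℝ) →L[ℝ] E →L[ℝ] ℝ) (ContinuousLinearMap.compL ℝ E F ℝ).flip

/-- The exterior derivative commutes with pull-back and vanishes on constant forms. -/
theorem isSmoothClosedOn_const (S : Set F) (α : F [⋀^Fin 2]→L[ℝ] ℝ) :
    IsSmoothClosedOn 𝓘(ℝ, F) S (fun _ => α) := by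
  intro k O φ hO hφ _
  have hφ' : ContDiffOn ℝ ∞ φ O := contMDiffOn_iff_contDiffOn.1 hφ
  have h1 : TwoForm.pullback 𝓘(ℝ, EuclideanSpace ℝ (Fin k)) 𝓘(ℝ, F) φ (fun _ => α) =
      fun y => α.compContinuousLinearMap (fderiv ℝ φ y) := by
    funext y
    change α.compContinuousLinearMap (mfderiv _ _ φ y) = _
    rw [mfderiv_eq_fderiv]
    rfl
  intro β
  have h1' : β = fun y => α.compContinuousLinearMap (fderiv ℝ φ y) := h1
  rw [h1']
  refine ⟨(contDiff_compContinuousLinearMap α).comp_contDiffOn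
    (hφ'.fderiv_of_isOpen hO (by simp)), fun y hy => ?_⟩
  have h2 : minSmoothness ℝ 2 ≤ ∞ := by
    rw [minSmoothness_of_isRCLikeNormedField]
    exact WithTop.coe_le_coe.2 le_top
  refine (extDeriv_pullback (r := ∞) (differentiableAt_const α)
    (hφ'.contDiffAt (hO.mem_nhds hy)) h2).trans ?_
  have : extDeriv (fun _ : F => α) (φ y) = 0 := by
    ext v
    rw [extDeriv_apply (by fun_prop)]
    simp
  rw [this]
  rfl

end ConstantForms

/-! ### Conformal rescalings of the standard form -/

theorem stdAlt_apply {n : ℕ} (x y : CSpace n) : stdAlt n ![x, y] = (inner ℂ x y).im := by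
  change ∑ j, ((x j).re * (y j).im - (y j).re * (x j).im) = _
  rw [PiLp.inner_apply, Complex.im_sum]
  refine Finset.sum_congr rfl fun j _ => ?_
  simp [Complex.mul_im]
  ring

/-- Serves for the derivative of `w ↦ h(w) w`, which at `z` sends `a` to `h(z) a + h'(a) z`. -/
theorem stdAlt_smul_add_smul {n : ℕ} (z a b : CSpace n) (h p q : ℂ) :
    stdAlt n ![h • a + p • z, h • b + q • z] =
      ‖h‖ ^ 2 * stdAlt n ![a, b]
        + ((star h * p).re * (inner ℂ z b).im - (star h * q).re * (inner ℂ z a).im)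
        - ((star h * p).im * (inner ℂ z b).re - (star h * q).im * (inner ℂ z a).re)
        + ‖z‖ ^ 2 * (star p * q).im := by
  have h1 : inner ℂ a z = (starRingEnd ℂ) (inner ℂ z a) := (inner_conj_symm a z).symm
  have h1r : (inner ℂ a z).re = (inner ℂ z a).re := by rw [h1, Complex.conj_re]
  have h1i : (inner ℂ a z).im = -(inner ℂ z a).im := by rw [h1, Complex.conj_im]
  have h2r : ((‖z‖ : ℂ) ^ 2).re = ‖z‖ ^ 2 := by norm_cast
  have h2i : ((‖z‖ : ℂ) ^ 2).im = 0 := by norm_cast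
  have h3 : ‖h‖ ^ 2 = h.re * h.re + h.im * h.im := by
    rw [← Complex.normSq_eq_norm_sq, Complex.normSq_apply]
  simp only [stdAlt_apply, inner_add_left, inner_add_right, inner_smul_left, inner_smul_right, h3]
  simp [Complex.mul_im, Complex.mul_re, h1r, h1i, h2r, h2i]
  ring

/-! ### The smooth locus of the node -/

section Node

variable {n : ℕ}

/-- The projection which forgets the `i`-th coordinate. -/
def dropCoord (i : Fin (n + 1)) : CSpace n →L[ℝ] EuclideanSpace ℂ (Fin n) :=
  LinearMap.toContinuousLinearMap
    { toFun := fun z => WithLp.toLp 2 fun j => z (i.succAbove j)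
      map_add' := fun _ _ => rfl
      map_smul' := fun _ _ => rfl }

@[simp] theorem dropCoord_apply (i : Fin (n + 1)) (z : CSpace n) (j : Fin n) :
    dropCoord i z j = z (i.succAbove j) := rfl

theorem CSpace.ext_dropCoord {i : Fin (n + 1)} {z w : CSpace n} (h0 : z i = w i)
    (h : dropCoord i z = dropCoord i w) : z = w := by
  ext k
  refine Fin.succAboveCases i h0 (fun j => ?_) k
  simpa using congrArg (fun v : EuclideanSpace ℂ (Fin n) => v j) h

/-- The square of the quotient of the missing coordinate by `a`, for a point on the node. -/
def nodeRadicand (a : ℂ) (w : EuclideanSpace ℂ (Fin n)) : ℂ := -(∑ j, w j ^ 2) / a ^ 2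

/-- The point on the node with given coordinates other than the `i`-th, whose `i`-th coordinate
lies in the half-plane around `a`. -/
def nodeSection (i : Fin (n + 1)) (a : ℂ) (w : EuclideanSpace ℂ (Fin n)) : CSpace n :=
  WithLp.toLp 2 (i.insertNth (a * nodeRadicand a w ^ (2⁻¹ : ℂ)) fun j => w j)

@[simp] theorem nodeSection_self (i : Fin (n + 1)) (a : ℂ) (w : EuclideanSpace ℂ (Fin n)) :
    nodeSection i a w i = a * nodeRadicand a w ^ (2⁻¹ : ℂ) := by simp [nodeSection]

@[simp] theorem nodeSection_succAbove (i : Fin (n + 1)) (a : ℂ) (w : EuclideanSpace ℂ (Fin n))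
    (j : Fin n) : nodeSection i a w (i.succAbove j) = w j := by simp [nodeSection]

theorem dropCoord_nodeSection (i : Fin (n + 1)) (a : ℂ) (w : EuclideanSpace ℂ (Fin n)) :
    dropCoord i (nodeSection i a w) = w := by
  ext j
  simp

theorem contDiff_nodeRadicand (a : ℂ) :
    ContDiff ℝ ∞ (nodeRadicand a : EuclideanSpace ℂ (Fin n) → ℂ) := by
  unfold nodeRadicand
  simp only [div_eq_mul_inv]
  refine (ContDiff.neg (ContDiff.sum fun j _ => ContDiff.pow ?_ 2)).mul contDiff_const
  exact contDiff_piLp_apply (𝕜 := ℝ) 2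

theorem contDiffOn_nodeSection (i : Fin (n + 1)) (a : ℂ) :
    ContDiffOn ℝ ∞ (nodeSection i a) (nodeRadicand a ⁻¹' Complex.slitPlane) := by
  rw [contDiffOn_piLp]
  intro k
  refine Fin.succAboveCases i ?_ (fun j => ?_) k
  · simp only [nodeSection_self]
    refine contDiffOn_const.mul fun w hw => ?_
    have h1 : ContDiffAt ℂ ∞ (fun x : ℂ => x ^ (2⁻¹ : ℂ)) (nodeRadicand a w) :=
      (analyticAt_id.cpow analyticAt_const hw).contDiffAt
    exact ((h1.restrict_scalars ℝ).comp w
      (contDiff_nodeRadicand a).contDiffAt).contDiffWithinAt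
  · simp only [nodeSection_succAbove]
    exact (contDiff_piLp_apply (𝕜 := ℝ) 2).contDiffOn

theorem isOpen_nodeRadicand_preimage (a : ℂ) :
    IsOpen (nodeRadicand a ⁻¹' Complex.slitPlane : Set (EuclideanSpace ℂ (Fin n))) :=
  Complex.isOpen_slitPlane.preimage (contDiff_nodeRadicand a).continuous

theorem nodeSection_mem_node (i : Fin (n + 1)) {a : ℂ} (ha : a ≠ 0)
    (w : EuclideanSpace ℂ (Fin n)) : nodeSection i a w ∈ node n := by
  have h1 : (nodeRadicand a w ^ (2⁻¹ : ℂ)) ^ 2 = nodeRadicand a w := by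
    exact Complex.cpow_nat_inv_pow (nodeRadicand a w) two_ne_zero
  change ∑ k, nodeSection i a w k ^ 2 = 0
  rw [Fin.sum_univ_succAbove _ i]
  simp only [nodeSection_self, nodeSection_succAbove, mul_pow, h1]
  rw [nodeRadicand]
  field_simp
  ring

/-- The principal root halves the argument, which then lies in `(-π/2, π/2)`. Squaring is thus a
bijection from the right half-plane onto the slit plane; `nodeRadicand_dropCoord_mem` uses the other
direction. -/
theorem Complex.re_cpow_inv_two_pos {t : ℂ} (ht : t ∈ Complex.slitPlane) :
    0 < (t ^ (2⁻¹ : ℂ)).re := by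
  have h0 := Complex.slitPlane_ne_zero ht
  rw [Complex.cpow_def_of_ne_zero h0, Complex.exp_re]
  have h1 := (Complex.mem_slitPlane_iff_arg.1 ht).1
  have h2 := Complex.neg_pi_lt_arg t
  have h3 := lt_of_le_of_ne (Complex.arg_le_pi t) h1
  have h4 : (Complex.log t * 2⁻¹).im = t.arg / 2 := by
    simp [Complex.mul_im, Complex.log_im, div_eq_mul_inv]
  rw [h4]
  exact mul_pos (Real.exp_pos _) (Real.cos_pos_of_mem_Ioo ⟨by linarith, by linarith⟩)

theorem re_nodeSection_div_pos (i : Fin (n + 1)) {a : ℂ} (ha : a ≠ 0)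
    {w : EuclideanSpace ℂ (Fin n)} (hw : nodeRadicand a w ∈ Complex.slitPlane) :
    0 < (nodeSection i a w i / a).re := by
  rw [nodeSection_self, mul_div_cancel_left₀ _ ha]
  exact Complex.re_cpow_inv_two_pos hw

theorem nodeRadicand_dropCoord {i : Fin (n + 1)} {a : ℂ} {z : CSpace n} (hz : z ∈ node n) :
    nodeRadicand a (dropCoord i z) = (z i / a) ^ 2 := by
  have h1 : ∑ k, z k ^ 2 = 0 := hz
  rw [Fin.sum_univ_succAbove _ i] at h1
  rw [nodeRadicand, div_pow]
  congr 1
  simp only [dropCoord_apply]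
  linear_combination -h1

theorem nodeRadicand_dropCoord_mem {i : Fin (n + 1)} {a : ℂ} {z : CSpace n} (hz : z ∈ node n)
    (hza : 0 < (z i / a).re) : nodeRadicand a (dropCoord i z) ∈ Complex.slitPlane := by
  rw [nodeRadicand_dropCoord hz, Complex.mem_slitPlane_iff]
  by_cases him : (z i / a).im = 0
  · left
    rw [pow_two, Complex.mul_re, him]
    nlinarith
  · right
    rw [pow_two, Complex.mul_im]
    have := mul_ne_zero hza.ne' him
    intro h
    apply this
    linarith

theorem nodeSection_dropCoord {i : Fin (n + 1)} {a : ℂ} (ha : a ≠ 0) {z : CSpace n}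
    (hz : z ∈ node n) (hza : 0 < (z i / a).re) : nodeSection i a (dropCoord i z) = z := by
  refine CSpace.ext_dropCoord (i := i) ?_ (dropCoord_nodeSection i a _)
  rw [nodeSection_self, nodeRadicand_dropCoord hz, Complex.sq_cpow_two_inv hza,
    mul_div_cancel₀ _ ha]

theorem exists_coord_ne_zero {z : CSpace n} (hz : z ≠ 0) : ∃ i, z i ≠ 0 := by
  by_contra! h
  exact hz (PiLp.ext h)

theorem isSmoothSubmanifold_node {A : Set (CSpace n)} (hA : IsOpen A) (hA0 : 0 ∉ A) :
    IsSmoothSubmanifold 𝓘(ℝ, CSpace n) (A ∩ node n) (2 * n) := by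
  rintro z ⟨hzA, hz⟩
  obtain ⟨i, hi⟩ := exists_coord_ne_zero (fun h : z = 0 => hA0 (h ▸ hzA))
  -- With this `a` the radicand equals `1` at the base point, well inside the slit plane. Near `z`
  -- the node is the graph of the principal root over the remaining coordinates.
  set a := z i with ha
  let e : EuclideanSpace ℝ (Fin (2 * n)) ≃L[ℝ] EuclideanSpace ℂ (Fin n) :=
    ContinuousLinearEquiv.ofFinrankEq (by simp [finrank_real_of_complex])
  let O : Set (EuclideanSpace ℂ (Fin n)) :=
    nodeRadicand a ⁻¹' Complex.slitPlane ∩ nodeSection i a ⁻¹' A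
  have hO : IsOpen O := (contDiffOn_nodeSection i a).continuousOn.isOpen_inter_preimage
    (isOpen_nodeRadicand_preimage a) hA
  have hbij : BijOn (nodeSection i a) O (A ∩ node n ∩ {z | 0 < (z i / a).re}) := by
    refine ⟨fun w hw => ⟨⟨hw.2, nodeSection_mem_node i hi w⟩, re_nodeSection_div_pos i hi hw.1⟩,
      (Function.LeftInverse.injective (dropCoord_nodeSection i a)).injOn, fun v hv => ?_⟩
    have h1 := nodeSection_dropCoord hi hv.1.2 hv.2
    refine ⟨dropCoord i v, ⟨nodeRadicand_dropCoord_mem hv.1.2 hv.2, ?_⟩, h1⟩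
    rw [mem_preimage, h1]
    exact hv.1.1
  refine ⟨{z | 0 < (z i / a).re}, e ⁻¹' O, nodeSection i a ∘ e, ?_, ?_,
    hO.preimage e.continuous, ?_, ?_, e.symm ∘ dropCoord i, ⟨?_, ?_⟩, ?_⟩
  · exact isOpen_lt continuous_const (by fun_prop)
  · rw [mem_ofPred_eq, ← ha, div_self hi]
    simp
  · exact hbij.comp ⟨fun _ h => h, e.injective.injOn, fun y hy => ⟨e.symm y, by simpa using hy⟩⟩
  · rw [contMDiffOn_iff_contDiffOn]
    exact ((contDiffOn_nodeSection i a).mono inter_subset_left).comp e.contDiff.contDiffOn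
      fun _ h => h
  · intro y _
    simp [dropCoord_nodeSection]
  · intro v hv
    simp [nodeSection_dropCoord hi hv.1.2 hv.2]
  · rw [contMDiffOn_iff_contDiffOn]
    exact (e.symm.contDiff.comp (dropCoord i).contDiff).contDiffOn

/-- The function `∑ z_k²` vanishes on the node, so both `0` and `2 ∑ z_k dz_k` are derivatives of it
within the node; they agree on tangent vectors. -/
theorem sum_mul_eq_zero_of_mem_tangentVectors {A : Set (CSpace n)} {z u : CSpace n}
    (hz : z ∈ A ∩ node n) (hu : u ∈ tangentVectors 𝓘(ℝ, CSpace n) (A ∩ node n) z) :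
    ∑ k, z k * u k = 0 := by
  have h1 : HasFDerivAt (fun z : CSpace n => ∑ k, z k ^ 2)
      (∑ k, (2 * z k) • (EuclideanSpace.proj k : CSpace n →L[ℂ] ℂ).restrictScalars ℝ) z := by
    refine HasFDerivAt.fun_sum fun k _ => ?_
    have h2 : HasFDerivAt (fun z : CSpace n => z k)
        ((EuclideanSpace.proj k : CSpace n →L[ℂ] ℂ).restrictScalars ℝ) z :=
      ((EuclideanSpace.proj k : CSpace n →L[ℂ] ℂ).restrictScalars ℝ).hasFDerivAt
    refine (h2.pow 2).congr_fderiv ?_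
    ext v
    simp
  have h2 : HasMFDerivWithinAt 𝓘(ℝ, CSpace n) 𝓘(ℝ, ℂ) (fun z : CSpace n => ∑ k, z k ^ 2)
    (A ∩ node n) z _ := h1.hasMFDerivAt.hasMFDerivWithinAt
  have h3 : HasFDerivWithinAt (fun z : CSpace n => ∑ k, z k ^ 2) (0 : CSpace n →L[ℝ] ℂ)
      (A ∩ node n) z :=
    (hasFDerivWithinAt_const (0 : ℂ) z _).congr (fun v hv => hv.2) hz.2
  have h4 := h2.apply_eq_of_mem_tangentVectors h3.hasMFDerivWithinAt hu
  have h5 : ∑ k, 2 * z k * u k = 0 := by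
    refine Eq.trans ?_ h4
    change _ = (∑ k, (2 * z k) • (EuclideanSpace.proj k : CSpace n →L[ℂ] ℂ).restrictScalars ℝ) u
    simp
  simp only [mul_assoc, ← Finset.mul_sum] at h5
  simpa using h5

/-- Differentiating `nodeSection` in the direction `dropCoord i v` gives a tangent vector `v'` that
agrees with `v` off the `i`-th coordinate. The linear equation satisfied by both fixes that
coordinate too, since `z i ≠ 0`. -/
theorem mem_tangentVectors_node {A : Set (CSpace n)} (hA : IsOpen A) (hA0 : 0 ∉ A) {z v : CSpace n}
    (hz : z ∈ A ∩ node n) (hv : ∑ k, z k * v k = 0) :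
    v ∈ tangentVectors 𝓘(ℝ, CSpace n) (A ∩ node n) z := by
  obtain ⟨i, hi⟩ := exists_coord_ne_zero (fun h : z = 0 => hA0 (h ▸ hz.1))
  set a := z i with ha
  let O : Set (EuclideanSpace ℂ (Fin n)) :=
    nodeRadicand a ⁻¹' Complex.slitPlane ∩ nodeSection i a ⁻¹' A
  have hO : IsOpen O := (contDiffOn_nodeSection i a).continuousOn.isOpen_inter_preimage
    (isOpen_nodeRadicand_preimage a) hA
  have hza : 0 < (z i / a).re := by
    rw [← ha, div_self hi]
    simp
  have h1 := nodeSection_dropCoord hi hz.2 hza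
  have hmem : dropCoord i z ∈ O := by
    refine ⟨nodeRadicand_dropCoord_mem hz.2 hza, ?_⟩
    rw [mem_preimage, h1]
    exact hz.1
  have hsm : ContDiffOn ℝ ∞ (nodeSection i a) O :=
    (contDiffOn_nodeSection i a).mono inter_subset_left
  have hS : MapsTo (nodeSection i a) O (A ∩ node n) :=
    fun w hw => ⟨hw.2, nodeSection_mem_node i hi w⟩
  have h2 := mfderiv_mem_tangentVectors hO hsm.contMDiffOn hS hmem (dropCoord i v)
  rw [h1, mfderiv_eq_fderiv] at h2
  obtain ⟨v', hv', h2⟩ : ∃ v' : CSpace n,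
      v' = fderiv ℝ (nodeSection i a) (dropCoord i z) (dropCoord i v) ∧
        v' ∈ tangentVectors 𝓘(ℝ, CSpace n) (A ∩ node n) z := ⟨_, rfl, h2⟩
  have h3 := sum_mul_eq_zero_of_mem_tangentVectors hz h2
  have h4 : HasFDerivAt (nodeSection i a) _ (dropCoord i z) :=
    ((hsm.contDiffAt (hO.mem_nhds hmem)).differentiableAt (by simp)).hasFDerivAt
  have h5 : dropCoord i v' = dropCoord i v := by
    have h6 := (dropCoord i).hasFDerivAt.comp (dropCoord i z) h4
    have h7 : dropCoord i ∘ nodeSection i a = id := funext (dropCoord_nodeSection i a)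
    rw [h7] at h6
    rw [hv']
    exact DFunLike.congr_fun (h6.unique (hasFDerivAt_id _)) (dropCoord i v)
  rw [Fin.sum_univ_succAbove _ i] at hv h3
  have h8 : ∀ j, v' (i.succAbove j) = v (i.succAbove j) :=
    fun j => congrArg (fun v : EuclideanSpace ℂ (Fin n) => v j) h5
  simp only [h8] at h3
  have h9 : v' i = v i := mul_left_cancel₀ hi (add_right_cancel (h3.trans hv.symm))
  rwa [CSpace.ext_dropCoord h9 h5] at h2

theorem isSymplecticSubmanifold_node {A : Set (CSpace n)} (hA : IsOpen A) (hA0 : 0 ∉ A) :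
    IsSymplecticSubmanifold 𝓘(ℝ, CSpace n) (A ∩ node n) (2 * n) (stdForm n) := by
  have key : ∀ z ∈ A ∩ node n, ∀ u : CSpace n, u ∈ tangentVectors 𝓘(ℝ, CSpace n) (A ∩ node n) z →
      u ≠ 0 → ∃ v : CSpace n, v ∈ tangentVectors 𝓘(ℝ, CSpace n) (A ∩ node n) z ∧
        stdAlt n ![u, v] ≠ 0 := by
    intro z hz u hu hu0
    -- The tangent equation is complex linear, so `iu` is tangent along with `u`, and `ω(u, iu) =
    -- |u|²`.
    refine ⟨Complex.I • u, mem_tangentVectors_node hA hA0 hz ?_, ?_⟩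
    · have : ∀ k, z k * (Complex.I • u) k = Complex.I * (z k * u k) := fun k => by
        simp only [PiLp.smul_apply, smul_eq_mul]
        ring
      simp only [this, ← Finset.mul_sum, sum_mul_eq_zero_of_mem_tangentVectors hz hu, mul_zero]
    · rw [stdAlt_apply, inner_smul_right, inner_self_eq_norm_sq_to_K]
      have h2 : ((‖u‖ : ℂ) ^ 2).re = ‖u‖ ^ 2 := by norm_cast
      simpa [Complex.mul_im, h2] using hu0
  exact ⟨isSmoothSubmanifold_node hA hA0, isSmoothClosedOn_const _ _, key⟩

end Node

/-! ### The derivative of a pointwise rescaling -/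

section Rescaling

variable {n : ℕ}

theorem exists_hasFDerivAt_norm_sq {f : CSpace n → CSpace n} {f' : CSpace n →L[ℝ] CSpace n}
    {z : CSpace n} (hf : HasFDerivAt f f' z) :
    ∃ D : CSpace n →L[ℝ] ℝ, HasFDerivAt (fun w => ‖f w‖ ^ 2) D z ∧
      ∀ a, D a = 2 * (inner ℂ (f z) (f' a)).re := by
  refine ⟨Complex.reCLM ∘L _,
    (Complex.reCLM.hasFDerivAt.comp z (hf.inner ℂ hf)).congr_of_eventuallyEq (Eventually.of_forall
      fun w => ?_), fun a => ?_⟩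
  · exact (inner_self_eq_norm_sq (𝕜 := ℂ) (f w)).symm
  · have h1 : (inner ℂ (f' a) (f z)).re = (inner ℂ (f z) (f' a)).re :=
      inner_re_symm (𝕜 := ℂ) (f' a) (f z)
    simp [fderivInnerCLM_apply, h1]
    ring

/-- If `|h(w) w|² = ε |w|² + c` near `z`, the pull-back of the standard form under `w ↦ h(w) w`
differs from `|h(z)|² ω` by a form which involves the radial and angular components only. -/
theorem stdAlt_rescaling {h : CSpace n → ℂ} {h' : CSpace n →L[ℝ] ℂ} {z : CSpace n}
    (hh : HasFDerivAt h h' z) (hz : z ≠ 0) (hhz : h z ≠ 0) {ε c : ℝ}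
    (hnorm : ∀ᶠ w in 𝓝 z, ‖h w • w‖ ^ 2 = ε * ‖w‖ ^ 2 + c)
    {H : CSpace n →L[ℝ] CSpace n} (hH : HasFDerivAt (fun w => h w • w) H z) (a b : CSpace n) :
    stdAlt n ![H a, H b] = ‖h z‖ ^ 2 * stdAlt n ![a, b]
      + (ε - ‖h z‖ ^ 2) / ‖z‖ ^ 2 *
        ((inner ℂ z a).re * (inner ℂ z b).im - (inner ℂ z b).re * (inner ℂ z a).im)
      + ε / ‖h z‖ ^ 2 * ((inner ℂ z a).re * (star (h z) * h' b).im
        - (inner ℂ z b).re * (star (h z) * h' a).im) := by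
  have hHa : ∀ a, H a = h z • a + h' a • z := fun a => by
    rw [hH.unique (hh.smul (hasFDerivAt_id z))]
    simp
  obtain ⟨D₁, hD₁, hD₁'⟩ := exists_hasFDerivAt_norm_sq hH
  obtain ⟨D₂, hD₂, hD₂'⟩ := exists_hasFDerivAt_norm_sq (hasFDerivAt_id z)
  have hD : D₁ = ε • D₂ :=
    hD₁.unique (((hD₂.const_mul ε).add_const c).congr_of_eventuallyEq hnorm)
  have hN : 0 < ‖z‖ ^ 2 := by positivity
  have hK : 0 < ‖h z‖ ^ 2 := by positivity
  have hzz : ((‖z‖ : ℂ) ^ 2).re = ‖z‖ ^ 2 := by norm_cast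
  have hzz' : ((‖z‖ : ℂ) ^ 2).im = 0 := by norm_cast
  have hK' : ‖h z‖ ^ 2 = (h z).re * (h z).re + (h z).im * (h z).im := by
    rw [← Complex.normSq_eq_norm_sq, Complex.normSq_apply]
  -- Differentiating `|h(w) w|² = ε|w|² + c` determines the real part of `star h * h'`. Only its
  -- imaginary part, the rotation of the phase, stays free.
  have hre : ∀ a, ‖z‖ ^ 2 * (star (h z) * h' a).re = (ε - ‖h z‖ ^ 2) * (inner ℂ z a).re := by
    intro a
    have h1 := DFunLike.congr_fun hD a
    rw [smul_apply, hD₁', hD₂', hHa] at h1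
    simp only [inner_add_right, inner_smul_left, inner_smul_right, inner_self_eq_norm_sq_to_K] at h1
    simp [Complex.mul_re, Complex.mul_im, hzz, hzz'] at h1
    rw [hK']
    simp [Complex.mul_re]
    linear_combination h1 / 2
  have him : ‖h z‖ ^ 2 * (star (h' a) * h' b).im =
      (star (h z) * h' a).re * (star (h z) * h' b).im
        - (star (h z) * h' a).im * (star (h z) * h' b).re := by
    rw [hK']
    simp [Complex.mul_re, Complex.mul_im]
    ring
  rw [hHa, hHa, stdAlt_smul_add_smul]
  have ha := hre a
  have hb := hre b
  generalize (star (h z) * h' a).re = pa at *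
  generalize (star (h z) * h' b).re = pb at *
  generalize (star (h z) * h' a).im = qa at *
  generalize (star (h z) * h' b).im = qb at *
  generalize (star (h' a) * h' b).im = s at *
  have ha' : pa = (ε - ‖h z‖ ^ 2) * (inner ℂ z a).re / ‖z‖ ^ 2 := by
    rw [eq_div_iff hN.ne']; linarith
  have hb' : pb = (ε - ‖h z‖ ^ 2) * (inner ℂ z b).re / ‖z‖ ^ 2 := by
    rw [eq_div_iff hN.ne']; linarith
  have hs : s = (pa * qb - qa * pb) / ‖h z‖ ^ 2 := by
    rw [eq_div_iff hK.ne']; linarith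
  rw [hs, ha', hb']
  field_simp
  ring

end Rescaling

/-! ### The radial map and the Hopf map -/

section RadialMap

variable {n : ℕ}

theorem contDiffAt_norm_CSpace {z : CSpace n} (hz : z ≠ 0) :
    ContDiffAt ℝ ∞ (fun w : CSpace n => ‖w‖) z :=
  contDiffAt_norm ℂ hz

/-- The inverse of the radial map. -/
def radialInv (n : ℕ) (lam : ℝ) (z : CSpace n) : CSpace n :=
  (Real.sqrt (‖z‖ ^ 2 - lam ^ 2) / ‖z‖) • z

theorem norm_radialMap {lam : ℝ} {z : CSpace n} (hz : z ≠ 0) :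
    ‖radialMap n lam z‖ = Real.sqrt (‖z‖ ^ 2 + lam ^ 2) := by
  rw [radialMap, norm_smul, Real.norm_of_nonneg (by positivity),
    div_mul_cancel₀ _ (norm_ne_zero_iff.2 hz)]

theorem norm_radialInv {lam : ℝ} {z : CSpace n} (hz : z ≠ 0) :
    ‖radialInv n lam z‖ = Real.sqrt (‖z‖ ^ 2 - lam ^ 2) := by
  rw [radialInv, norm_smul, Real.norm_of_nonneg (by positivity),
    div_mul_cancel₀ _ (norm_ne_zero_iff.2 hz)]

theorem radialInv_radialMap {lam : ℝ} (hlam : 0 < lam) {z : CSpace n} (hz : z ≠ 0) :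
    radialInv n lam (radialMap n lam z) = z := by
  have h0 : 0 < ‖z‖ := norm_pos_iff.2 hz
  have h1 : 0 < Real.sqrt (‖z‖ ^ 2 + lam ^ 2) := Real.sqrt_pos.2 (by positivity)
  rw [radialInv, norm_radialMap hz, Real.sq_sqrt (by positivity), add_sub_cancel_right,
    Real.sqrt_sq h0.le, radialMap, smul_smul]
  rw [div_mul_div_cancel₀ h1.ne', div_self h0.ne', one_smul]

theorem radialInv_ne_zero {lam : ℝ} (hlam : 0 < lam) {w : CSpace n} (hw : lam < ‖w‖) :
    radialInv n lam w ≠ 0 := by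
  have h0 : 0 < ‖w‖ := hlam.trans hw
  rw [← norm_ne_zero_iff, norm_radialInv (norm_pos_iff.1 h0)]
  exact (Real.sqrt_pos.2 (by nlinarith)).ne'

theorem radialMap_radialInv {lam : ℝ} (hlam : 0 < lam) {w : CSpace n} (hw : lam < ‖w‖) :
    radialMap n lam (radialInv n lam w) = w := by
  have h0 : 0 < ‖w‖ := hlam.trans hw
  have h2 : 0 < ‖w‖ ^ 2 - lam ^ 2 := by nlinarith
  have h1 : 0 < Real.sqrt (‖w‖ ^ 2 - lam ^ 2) := Real.sqrt_pos.2 h2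
  rw [radialMap, norm_radialInv (norm_pos_iff.1 h0), Real.sq_sqrt h2.le, sub_add_cancel,
    Real.sqrt_sq h0.le, radialInv, smul_smul]
  rw [div_mul_div_cancel₀ h1.ne', div_self h0.ne', one_smul]

theorem contDiffAt_radialMap {lam : ℝ} {z : CSpace n} (hz : z ≠ 0) :
    ContDiffAt ℝ ∞ (radialMap n lam) z := by
  have h0 : 0 < ‖z‖ := norm_pos_iff.2 hz
  have h1 : ContDiffAt ℝ ∞ (fun w : CSpace n => ‖w‖ ^ 2 + lam ^ 2) z :=
    ((contDiffAt_norm_CSpace hz).pow 2).add contDiffAt_const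
  exact ((h1.sqrt (by positivity)).div (contDiffAt_norm_CSpace hz) h0.ne').smul contDiffAt_id

theorem contDiffAt_radialInv {lam : ℝ} (hlam : 0 < lam) {w : CSpace n} (hw : lam < ‖w‖) :
    ContDiffAt ℝ ∞ (radialInv n lam) w := by
  have h0 : 0 < ‖w‖ := hlam.trans hw
  have h2 : 0 < ‖w‖ ^ 2 - lam ^ 2 := by nlinarith
  have hw0 : w ≠ 0 := norm_pos_iff.1 h0
  have h3 : ContDiffAt ℝ ∞ (fun w : CSpace n => ‖w‖ ^ 2 - lam ^ 2) w :=
    ((contDiffAt_norm_CSpace hw0).pow 2).sub contDiffAt_const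
  exact ((h3.sqrt h2.ne').div (contDiffAt_norm_CSpace hw0) h0.ne').smul contDiffAt_id

/-- The factor by which `z` has to be multiplied to become a unit vector with positive `i`-th
coordinate. -/
def hopfFactor (i : Fin (n + 1)) (z : CSpace n) : ℂ := star (z i) / (‖z i‖ * ‖z‖ : ℝ)

theorem norm_hopfFactor {i : Fin (n + 1)} {z : CSpace n} (hz : z i ≠ 0) :
    ‖hopfFactor i z‖ = ‖z‖⁻¹ := by
  have h0 : ‖z i‖ ≠ 0 := norm_ne_zero_iff.2 hz
  rw [hopfFactor, norm_div, norm_star, Complex.norm_real, norm_mul, norm_norm, norm_norm,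
    div_mul_cancel_left₀ h0]

theorem contDiffAt_hopfFactor {i : Fin (n + 1)} {z : CSpace n} (hz : z i ≠ 0) :
    ContDiffAt ℝ ∞ (hopfFactor i) z := by
  have hz0 : z ≠ 0 := fun h => hz (by rw [h]; rfl)
  have h1 : ContDiffAt ℝ ∞ (fun w : CSpace n => w i) z :=
    (contDiff_piLp_apply (𝕜 := ℝ) 2).contDiffAt
  have h2 : ContDiffAt ℝ ∞ (fun w : CSpace n => ‖w i‖ * ‖w‖) z :=
    (h1.norm ℝ hz).mul (contDiffAt_norm_CSpace hz0)
  have h3 : ContDiffAt ℝ ∞ (fun w : CSpace n => ((‖w i‖ * ‖w‖ : ℝ) : ℂ)) z :=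
    Complex.ofRealCLM.contDiff.contDiffAt.comp z h2
  have h4 : ContDiffAt ℝ ∞ (fun w : CSpace n => star (w i)) z :=
    Complex.conjCLE.contDiff.contDiffAt.comp z h1
  unfold hopfFactor
  simp only [div_eq_mul_inv]
  refine h4.mul (h3.inv ?_)
  rw [Complex.ofReal_ne_zero]
  exact mul_ne_zero (norm_ne_zero_iff.2 hz) (norm_ne_zero_iff.2 hz0)

theorem contDiffAt_hopfFactor_smul {i : Fin (n + 1)} {z : CSpace n} (hz : z i ≠ 0) :
    ContDiffAt ℝ ∞ (fun w => hopfFactor i w • w) z :=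
  (contDiffAt_hopfFactor hz).smul contDiffAt_id

/-- The pull-back of the standard form under the radial map. -/
theorem stdAlt_fderiv_radialMap {lam : ℝ} (hlam : 0 < lam) {i : Fin (n + 1)} {z : CSpace n}
    (hz : z i ≠ 0) (a b : CSpace n) :
    stdAlt n ![fderiv ℝ (radialMap n lam) z a, fderiv ℝ (radialMap n lam) z b] =
      stdAlt n ![a, b] + lam ^ 2 * stdAlt n ![fderiv ℝ (fun w => hopfFactor i w • w) z a,
        fderiv ℝ (fun w => hopfFactor i w • w) z b] := by
  have hz0 : z ≠ 0 := fun h => hz (by rw [h]; rfl)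
  have h0 : 0 < ‖z‖ := norm_pos_iff.2 hz0
  have hθ := contDiffAt_hopfFactor hz
  -- The image lies in the unit sphere: `ε = 0` and `c = 1`, so the phase term drops out.
  have hθnorm : ∀ᶠ w in 𝓝 z, ‖hopfFactor i w • w‖ ^ 2 = 0 * ‖w‖ ^ 2 + 1 := by
    have : ∀ᶠ w : CSpace n in 𝓝 z, w i ≠ 0 :=
      (isOpen_ne_fun (by fun_prop) continuous_const).mem_nhds hz
    filter_upwards [this] with w hw
    have hw0 : w ≠ 0 := fun h => hw (by rw [h]; rfl)
    rw [norm_smul, norm_hopfFactor hw, inv_mul_cancel₀ (norm_ne_zero_iff.2 hw0)]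
    ring
  have hθ0 : hopfFactor i z ≠ 0 := by
    rw [← norm_ne_zero_iff, norm_hopfFactor hz]
    exact inv_ne_zero h0.ne'
  have hθd : HasFDerivAt (fun w => hopfFactor i w • w) _ z :=
    ((contDiffAt_hopfFactor_smul hz).differentiableAt (by simp)).hasFDerivAt
  rw [stdAlt_rescaling (hθ.differentiableAt (by simp)).hasFDerivAt hz0 hθ0 hθnorm hθd a b]
  let r : CSpace n → ℝ := fun w => Real.sqrt (‖w‖ ^ 2 + lam ^ 2) / ‖w‖
  have hr : ContDiffAt ℝ ∞ r z :=
    ContDiffAt.div (ContDiffAt.sqrt (((contDiffAt_norm_CSpace hz0).pow 2).add contDiffAt_const)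
      (by positivity)) (contDiffAt_norm_CSpace hz0) h0.ne'
  have hr' : HasFDerivAt (fun w => (r w : ℂ)) (Complex.ofRealCLM ∘L fderiv ℝ r z) z :=
    Complex.ofRealCLM.hasFDerivAt.comp z (hr.differentiableAt (by simp)).hasFDerivAt
  have hF : radialMap n lam = fun w => (r w : ℂ) • w := by
    funext w
    rw [radialMap, Complex.coe_smul]
  have hrnorm : ∀ᶠ w in 𝓝 z, ‖(r w : ℂ) • w‖ ^ 2 = 1 * ‖w‖ ^ 2 + lam ^ 2 := by
    filter_upwards [isOpen_ne.mem_nhds hz0] with w hw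
    have := congrFun hF w
    rw [← this, norm_radialMap hw, Real.sq_sqrt (by positivity), one_mul]
  have hr0 : (r z : ℂ) ≠ 0 := by
    rw [Complex.ofReal_ne_zero]
    exact (div_pos (Real.sqrt_pos.2 (by positivity)) h0).ne'
  have hrz : ‖(r z : ℂ)‖ ^ 2 = (‖z‖ ^ 2 + lam ^ 2) / ‖z‖ ^ 2 := by
    rw [Complex.norm_real, Real.norm_eq_abs, sq_abs, div_pow, Real.sq_sqrt (by positivity)]
  have hFd : HasFDerivAt (fun w => (r w : ℂ) • w) (fderiv ℝ (radialMap n lam) z) z := by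
    rw [← hF]
    exact ((contDiffAt_radialMap hz0).differentiableAt (by simp)).hasFDerivAt
  rw [stdAlt_rescaling hr' hz0 hr0 hrnorm hFd a b, hrz, norm_hopfFactor hz]
  -- The factor `r` is real, so here the phase term vanishes although `ε = 1`.
  have him : ∀ a, (star (r z : ℂ) * (Complex.ofRealCLM ∘L fderiv ℝ r z) a).im = 0 := fun a => by
    simp [Complex.mul_im]
  rw [him, him]
  field_simp
  ring

end RadialMap

/-! ### The resolution -/

section Resolution

variable {n : ℕ}

open Classical in
/-- The line spanned by a non-zero vector. -/
def lineOf (z : CSpace n) : PSpace n :=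
  if h : z ≠ 0 then Projectivization.mk ℂ z h else (PSpace.affineChart 0).symm 0

theorem lineOf_of_ne_zero {z : CSpace n} (hz : z ≠ 0) : lineOf z = Projectivization.mk ℂ z hz :=
  dif_pos hz

theorem lineOf_eq_of_mem {l : PSpace n} {z : CSpace n} (hz : z ≠ 0) (hzl : z ∈ l.submodule) :
    lineOf z = l := by
  rw [lineOf_of_ne_zero hz]
  induction l using Projectivization.ind with
  | h v hv =>
    rw [Projectivization.submodule_mk, Submodule.mem_span_singleton] at hzl
    exact (Projectivization.mk_eq_mk_iff' ℂ z v hz hv).2 hzl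

theorem contMDiffAt_lineOf {z : CSpace n} (hz : z ≠ 0) :
    ContMDiffAt 𝓘(ℝ, CSpace n) 𝓘(ℝ, EuclideanSpace ℂ (Fin n)) ∞ (lineOf : CSpace n → PSpace n)
      z := by
  set l : PSpace n := Projectivization.mk ℂ z hz with hl
  set i := PSpace.chartIndex l with hi
  have hzi : z i ≠ 0 := (PSpace.rep_mk_ne_zero_iff i z hz).1 (PSpace.chartIndex_spec l)
  let q : CSpace n → EuclideanSpace ℂ (Fin n) :=
    fun w => WithLp.toLp 2 fun j => w (i.succAbove j) / w i
  have hq : ContDiffAt ℝ ∞ q z := by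
    rw [contDiffAt_piLp]
    intro j
    have h1 : ∀ k, ContDiffAt ℝ ∞ (fun w : CSpace n => w k) z :=
      fun k => (contDiff_piLp_apply (𝕜 := ℝ) 2).contDiffAt
    change ContDiffAt ℝ ∞ (fun w : CSpace n => w (i.succAbove j) / w i) z
    simp only [div_eq_mul_inv]
    exact (h1 _).mul ((h1 i).inv hzi)
  have hsymm : ContMDiff 𝓘(ℝ, EuclideanSpace ℂ (Fin n)) 𝓘(ℝ, EuclideanSpace ℂ (Fin n)) ∞
      (PSpace.affineChart i).symm := by
    rw [← contMDiffOn_univ]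
    exact contMDiffOn_chart_symm (x := l)
  refine (hsymm.contMDiffAt.comp z hq.contMDiffAt).congr_of_eventuallyEq ?_
  have : ∀ᶠ w : CSpace n in 𝓝 z, w i ≠ 0 :=
    (isOpen_ne_fun (by fun_prop) continuous_const).mem_nhds hzi
  filter_upwards [this] with w hw
  have hw0 : w ≠ 0 := fun h => hw (by rw [h]; rfl)
  rw [lineOf_of_ne_zero hw0, Function.comp_apply,
    ← (PSpace.affineChart i).left_inv ((PSpace.rep_mk_ne_zero_iff i w hw0).2 hw)]
  exact congrArg _ (PSpace.affineCoord_mk i w hw0)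

/-- The formula does not depend on the spanning vector: replacing `v` by `a v` brings in `star a * a
/ ‖a‖ ^ 2 = 1`. -/
theorem hopfSection_mk (i : Fin (n + 1)) {v : CSpace n} (hv : v ≠ 0) :
    hopfSection i (Projectivization.mk ℂ v hv) = hopfFactor i v • v := by
  obtain ⟨a, ha⟩ := Projectivization.exists_smul_eq_mk_rep ℂ v hv
  have ha0 : (a : ℂ) ≠ 0 := a.ne_zero
  have ha1 : (‖(a : ℂ)‖ : ℂ) ≠ 0 := by simp
  have h1 : star (a : ℂ) * a = (‖(a : ℂ)‖ : ℂ) ^ 2 := Complex.conj_mul' _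
  rw [hopfSection, hopfFactor, ← ha, Units.smul_def, smul_smul]
  congr 1
  simp only [PiLp.smul_apply, smul_eq_mul, norm_mul, norm_smul, star_mul']
  push_cast
  by_cases hvi : v i = 0
  · simp [hvi]
  have h2 : (‖v i‖ : ℂ) ≠ 0 := by simpa using hvi
  have h3 : (‖v‖ : ℂ) ≠ 0 := by simpa using hv
  field_simp
  linear_combination (star (v i)) * h1

/-- Ensures that the `mfderiv` in `fubiniStudy` is a true derivative and not the default value `0`.
-/
theorem mdifferentiableAt_hopfSection (l : PSpace n) :
    MDifferentiableAt 𝓘(ℝ, EuclideanSpace ℂ (Fin n)) 𝓘(ℝ, CSpace n)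
      (hopfSection (PSpace.chartIndex l)) l := by
  set i := PSpace.chartIndex l with hi
  have hmem : l ∈ (PSpace.affineChart i).source := PSpace.chartIndex_spec l
  have h1 : ContMDiffAt 𝓘(ℝ, EuclideanSpace ℂ (Fin n)) 𝓘(ℝ, EuclideanSpace ℂ (Fin n)) ∞
      (PSpace.affineChart i) l :=
    contMDiffOn_chart.contMDiffAt ((PSpace.affineChart i).open_source.mem_nhds hmem)
  have h2 : ContDiffAt ℝ ∞ (fun w => hopfFactor i (PSpace.affineVec i w) • PSpace.affineVec i w)
      (PSpace.affineChart i l) :=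
    ContDiffAt.comp (g := fun w => hopfFactor i w • w) (f := PSpace.affineVec i)
      (PSpace.affineChart i l) (contDiffAt_hopfFactor_smul (by simp))
      (PSpace.contDiff_affineVec i).contDiffAt
  refine ((h2.contMDiffAt.comp l h1).congr_of_eventuallyEq ?_).mdifferentiableAt (by simp)
  filter_upwards [(PSpace.affineChart i).open_source.mem_nhds hmem] with m hm
  conv_lhs => rw [← (PSpace.affineChart i).left_inv hm]
  exact hopfSection_mk i (PSpace.affineVec_ne_zero i _)

theorem smul_mem_node (c : ℂ) {z : CSpace n} (hz : z ∈ node n) : c • z ∈ node n := by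
  change ∑ k, (c • z) k ^ 2 = 0
  have h1 : ∑ k, z k ^ 2 = 0 := hz
  simp only [PiLp.smul_apply, smul_eq_mul, mul_pow, ← Finset.mul_sum, h1, mul_zero]

theorem real_smul_mem_node (c : ℝ) {z : CSpace n} (hz : z ∈ node n) : c • z ∈ node n := by
  rw [← Complex.coe_smul]
  exact smul_mem_node _ hz

theorem lineOf_mem_quadric {z : CSpace n} (hz : z ≠ 0) (hzn : z ∈ node n) :
    lineOf z ∈ quadric n := by
  intro w hw
  rw [lineOf_of_ne_zero hz, Projectivization.submodule_mk, Submodule.mem_span_singleton] at hw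
  obtain ⟨c, rfl⟩ := hw
  exact smul_mem_node c hzn

theorem real_smul_mem_lineOf (c : ℝ) {z : CSpace n} (hz : z ≠ 0) :
    c • z ∈ (lineOf z).submodule := by
  rw [lineOf_of_ne_zero hz, Projectivization.submodule_mk, Submodule.mem_span_singleton]
  exact ⟨c, Complex.coe_smul c z⟩

/-- The line is recovered as the span of `w`, and `hB` keeps the root in `radialInv` away from `0`.
Leaving `A` and `B` general covers open and closed balls at once. -/
theorem isDiffeoOn_radialMap {lam : ℝ} (hlam : 0 < lam) {A B : Set (CSpace n)}
    (hAB : ∀ z ≠ 0, z ∈ A ↔ radialMap n lam z ∈ B) (hB : ∀ w ∈ B, lam < ‖w‖) :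
    IsDiffeoOn (ambientModel n) 𝓘(ℝ, CSpace n)
      ((resolution n ∩ projC n ⁻¹' A) \ exceptionalDivisor n) (B ∩ node n)
      (radialMap n lam ∘ projC n) := by
  let g : CSpace n → PSpace n × CSpace n := fun w => (lineOf w, radialInv n lam w)
  have hS0 : ∀ x ∈ (resolution n ∩ projC n ⁻¹' A) \ exceptionalDivisor n, x.2 ≠ 0 :=
    fun x hx h => hx.2 ⟨hx.1.1, h⟩
  have hf : MapsTo (radialMap n lam ∘ projC n)
      ((resolution n ∩ projC n ⁻¹' A) \ exceptionalDivisor n) (B ∩ node n) := fun x hx =>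
    ⟨(hAB _ (hS0 x hx)).1 hx.1.2, real_smul_mem_node _ (hx.1.1.1 _ hx.1.1.2)⟩
  have hg : MapsTo g (B ∩ node n)
      ((resolution n ∩ projC n ⁻¹' A) \ exceptionalDivisor n) := fun w hw => by
    have hlw := hB w hw.1
    have hw0 : w ≠ 0 := norm_pos_iff.1 (hlam.trans hlw)
    refine ⟨⟨⟨lineOf_mem_quadric hw0 hw.2, real_smul_mem_lineOf _ hw0⟩, ?_⟩,
      fun h => radialInv_ne_zero hlam hlw h.2⟩
    refine (hAB _ (radialInv_ne_zero hlam hlw)).2 ?_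
    rw [radialMap_radialInv hlam hlw]
    exact hw.1
  have hgf : InvOn g (radialMap n lam ∘ projC n)
      ((resolution n ∩ projC n ⁻¹' A) \ exceptionalDivisor n) (B ∩ node n) := by
    refine ⟨fun x hx => ?_, fun w hw => radialMap_radialInv hlam (hB w hw.1)⟩
    have hlx : lam < ‖radialMap n lam x.2‖ := hB _ (hf hx).1
    refine Prod.ext ?_ (radialInv_radialMap hlam (hS0 x hx))
    refine lineOf_eq_of_mem (norm_pos_iff.1 (hlam.trans hlx)) ?_
    change (_ : ℝ) • x.2 ∈ x.1.submodule
    rw [← Complex.coe_smul]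
    exact x.1.submodule.smul_mem _ hx.1.1.2
  refine ⟨hgf.bijOn hf hg, fun x hx => ?_, g, hgf, fun w hw => ?_⟩
  · exact ((contDiffAt_radialMap (hS0 x hx)).contMDiffAt.comp x
      contMDiffAt_snd).contMDiffWithinAt
  · have hlw := hB w hw.1
    exact ((contMDiffAt_lineOf (norm_pos_iff.1 (hlam.trans hlw))).prodMk
      (contDiffAt_radialInv hlam hlw).contMDiffAt).contMDiffWithinAt

theorem fubiniStudy_apply (l : PSpace n) (u v : EuclideanSpace ℂ (Fin n)) :
    fubiniStudy n l ![u, v] = stdAlt n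
      ![mfderiv 𝓘(ℝ, EuclideanSpace ℂ (Fin n)) 𝓘(ℝ, CSpace n)
          (hopfSection (PSpace.chartIndex l)) l u,
        mfderiv 𝓘(ℝ, EuclideanSpace ℂ (Fin n)) 𝓘(ℝ, CSpace n)
          (hopfSection (PSpace.chartIndex l)) l v] := by
  change stdAlt n (fun k => mfderiv 𝓘(ℝ, EuclideanSpace ℂ (Fin n)) 𝓘(ℝ, CSpace n)
    (hopfSection (PSpace.chartIndex l)) l (![u, v] k)) = _
  refine congrArg (stdAlt n) ?_
  ext k
  fin_cases k <;> rfl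

theorem rho_apply (lam : ℝ) (x : PSpace n × CSpace n)
    (u v : EuclideanSpace ℂ (Fin n) × CSpace n) :
    rho n lam x ![u, v] =
      stdAlt n ![u.2, v.2] + lam ^ 2 * fubiniStudy n x.1 ![u.1, v.1] := by
  have h1 : TwoForm.pullback (ambientModel n) 𝓘(ℝ, CSpace n) (projC n) (stdForm n) x ![u, v] =
      stdAlt n ![u.2, v.2] := by
    change stdAlt n (fun k => mfderiv (ambientModel n) 𝓘(ℝ, CSpace n) Prod.snd x (![u, v] k)) = _
    rw [mfderiv_snd]
    refine congrArg (stdAlt n) ?_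
    ext k
    fin_cases k <;> rfl
  have h2 : TwoForm.pullback (ambientModel n) 𝓘(ℝ, EuclideanSpace ℂ (Fin n)) (projP n)
      (fubiniStudy n) x ![u, v] = fubiniStudy n x.1 ![u.1, v.1] := by
    change fubiniStudy n x.1 (fun k => mfderiv (ambientModel n) 𝓘(ℝ, EuclideanSpace ℂ (Fin n))
      Prod.fst x (![u, v] k)) = _
    rw [mfderiv_fst]
    refine congrArg (fubiniStudy n x.1) ?_
    ext k
    fin_cases k <;> rfl
  rw [← h1, ← h2]
  rfl

theorem mfderivWithin_radialMap_comp_projC {lam : ℝ} {S : Set (PSpace n × CSpace n)}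
    {x : PSpace n × CSpace n} (hx : x.2 ≠ 0) {u : EuclideanSpace ℂ (Fin n) × CSpace n}
    (hu : u ∈ tangentVectors (ambientModel n) S x) :
    mfderivWithin (ambientModel n) 𝓘(ℝ, CSpace n) (radialMap n lam ∘ projC n) S x u =
      fderiv ℝ (radialMap n lam) x.2 u.2 := by
  have h0 : HasMFDerivAt (ambientModel n) 𝓘(ℝ, CSpace n) (projC n) x
      (ContinuousLinearMap.snd ℝ (EuclideanSpace ℂ (Fin n)) (CSpace n)) := hasMFDerivAt_snd x
  have h1 : HasMFDerivAt 𝓘(ℝ, CSpace n) 𝓘(ℝ, CSpace n) (radialMap n lam) (projC n x) _ :=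
    ((contDiffAt_radialMap hx).differentiableAt (by simp)).hasFDerivAt.hasMFDerivAt
  have h2 := (h1.comp x h0).hasMFDerivWithinAt (s := S)
  exact h2.mdifferentiableWithinAt.hasMFDerivWithinAt.apply_eq_of_mem_tangentVectors h2 hu

/-- The maps `hopfSection i ∘ p` and `θ ∘ π` agree only on `S`, where `y.2` spans the line `y.1`.
That suffices for equal derivatives on tangent vectors. The index `i` is frozen at its value for
`x.1`. -/
theorem mfderiv_hopfSection_apply {S : Set (PSpace n × CSpace n)} {x : PSpace n × CSpace n}
    (hx : x ∈ S) (hS : ∀ y ∈ S, y.2 ≠ 0 ∧ y.2 ∈ y.1.submodule)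
    (hxi : x.2 (PSpace.chartIndex x.1) ≠ 0) {u : EuclideanSpace ℂ (Fin n) × CSpace n}
    (hu : u ∈ tangentVectors (ambientModel n) S x) :
    mfderiv 𝓘(ℝ, EuclideanSpace ℂ (Fin n)) 𝓘(ℝ, CSpace n)
        (hopfSection (PSpace.chartIndex x.1)) x.1 u.1 =
      fderiv ℝ (fun w => hopfFactor (PSpace.chartIndex x.1) w • w) x.2 u.2 := by
  set i := PSpace.chartIndex x.1
  have hsnd : HasMFDerivAt (ambientModel n) 𝓘(ℝ, CSpace n) (projC n) x
      (ContinuousLinearMap.snd ℝ (EuclideanSpace ℂ (Fin n)) (CSpace n)) := hasMFDerivAt_snd x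
  have hfst : HasMFDerivAt (ambientModel n) 𝓘(ℝ, EuclideanSpace ℂ (Fin n)) (projP n) x
      (ContinuousLinearMap.fst ℝ (EuclideanSpace ℂ (Fin n)) (CSpace n)) := hasMFDerivAt_fst x
  have h1 : HasMFDerivAt 𝓘(ℝ, CSpace n) 𝓘(ℝ, CSpace n) (fun w => hopfFactor i w • w)
      (projC n x) _ :=
    ((contDiffAt_hopfFactor_smul hxi).differentiableAt (by simp)).hasFDerivAt.hasMFDerivAt
  have h2 := (h1.comp x hsnd).hasMFDerivWithinAt (s := S)
  have h3 : HasMFDerivAt 𝓘(ℝ, EuclideanSpace ℂ (Fin n)) 𝓘(ℝ, CSpace n) (hopfSection i)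
      (projP n x) _ := (mdifferentiableAt_hopfSection x.1).hasMFDerivAt
  have h4 := (h3.comp x hfst).hasMFDerivWithinAt (s := S)
  have h5 : ∀ y ∈ S, ((fun w => hopfFactor i w • w) ∘ projC n) y =
      (hopfSection i ∘ projP n) y := fun y hy => by
    have h6 := hopfSection_mk i (hS y hy).1
    rw [← lineOf_of_ne_zero (hS y hy).1, lineOf_eq_of_mem (hS y hy).1 (hS y hy).2] at h6
    exact h6.symm
  exact h4.apply_eq_of_eqOn h2 (fun y hy => (h5 y hy).symm) hx hu

theorem stdAlt_mfderivWithin_radialMap {lam : ℝ} (hlam : 0 < lam)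
    {S : Set (PSpace n × CSpace n)} {x : PSpace n × CSpace n} (hx : x ∈ S)
    (hS : ∀ y ∈ S, y.2 ≠ 0 ∧ y.2 ∈ y.1.submodule) {u v : EuclideanSpace ℂ (Fin n) × CSpace n}
    (hu : u ∈ tangentVectors (ambientModel n) S x)
    (hv : v ∈ tangentVectors (ambientModel n) S x) {a b : CSpace n}
    (ha : a = mfderivWithin (ambientModel n) 𝓘(ℝ, CSpace n) (radialMap n lam ∘ projC n) S x u)
    (hb : b = mfderivWithin (ambientModel n) 𝓘(ℝ, CSpace n) (radialMap n lam ∘ projC n) S x v) :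
    stdAlt n ![a, b] = rho n lam x ![u, v] := by
  have hxi : x.2 (PSpace.chartIndex x.1) ≠ 0 := by
    have h1 := PSpace.chartIndex_spec x.1
    have h2 : x.1 = Projectivization.mk ℂ x.2 (hS x hx).1 := by
      rw [← lineOf_of_ne_zero (hS x hx).1, lineOf_eq_of_mem (hS x hx).1 (hS x hx).2]
    generalize PSpace.chartIndex x.1 = i at h1 ⊢
    rw [h2] at h1
    exact (PSpace.rep_mk_ne_zero_iff i _ _).1 h1
  rw [ha.trans (mfderivWithin_radialMap_comp_projC (hS x hx).1 hu),
    hb.trans (mfderivWithin_radialMap_comp_projC (hS x hx).1 hv), rho_apply, fubiniStudy_apply,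
    mfderiv_hopfSection_apply hx hS hxi hu, mfderiv_hopfSection_apply hx hS hxi hv]
  exact stdAlt_fderiv_radialMap hlam hxi u.2 v.2

theorem isSymplectomorphismOn_radialMap {lam : ℝ} (hlam : 0 < lam) {A B : Set (CSpace n)}
    (hAB : ∀ z ≠ 0, z ∈ A ↔ radialMap n lam z ∈ B) (hB : ∀ w ∈ B, lam < ‖w‖) :
    IsSymplectomorphismOn (ambientModel n) 𝓘(ℝ, CSpace n)
      ((resolution n ∩ projC n ⁻¹' A) \ exceptionalDivisor n) (rho n lam) (B ∩ node n) (stdForm n)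
      (radialMap n lam ∘ projC n) :=
  ⟨isDiffeoOn_radialMap hlam hAB hB, fun _ hx _ hu _ hv => stdAlt_mfderivWithin_radialMap hlam hx
    (fun _ hy => ⟨fun h => hy.2 ⟨hy.1.1, h⟩, hy.1.1.2⟩) hu hv rfl rfl⟩

end Resolution

end

/-! ### The balls and the shell -/

theorem mainTheorem8 (n : ℕ) (lam δ : ℝ) (hlam : 0 < lam) (hδ : 0 < δ) :
    -- the punctured neighbourhood of the exceptional divisor and the shell (open balls)
    IsSymplecticSubmanifold (ambientModel n)
      ((resolution n ∩ projC n ⁻¹' Metric.ball 0 δ) \ exceptionalDivisor n) (2 * n) (rho n lam) ∧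
    IsSymplecticSubmanifold 𝓘(ℝ, CSpace n)
      ((Metric.ball 0 (Real.sqrt (lam ^ 2 + δ ^ 2)) \ Metric.closedBall 0 lam) ∩ node n) (2 * n)
      (stdForm n) ∧
    IsSymplectomorphismOn (ambientModel n) 𝓘(ℝ, CSpace n)
      ((resolution n ∩ projC n ⁻¹' Metric.ball 0 δ) \ exceptionalDivisor n) (rho n lam)
      ((Metric.ball 0 (Real.sqrt (lam ^ 2 + δ ^ 2)) \ Metric.closedBall 0 lam) ∩ node n)
      (stdForm n) (radialMap n lam ∘ projC n) ∧
    -- the same with closed balls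
    IsSymplectomorphismOn (ambientModel n) 𝓘(ℝ, CSpace n)
      ((resolution n ∩ projC n ⁻¹' Metric.closedBall 0 δ) \ exceptionalDivisor n) (rho n lam)
      ((Metric.closedBall 0 (Real.sqrt (lam ^ 2 + δ ^ 2)) \ Metric.closedBall 0 lam) ∩ node n)
      (stdForm n) (radialMap n lam ∘ projC n) := by
  have hmap : ∀ z : CSpace n, z ≠ 0 → ‖radialMap n lam z‖ ^ 2 = ‖z‖ ^ 2 + lam ^ 2 := fun z hz => by
    rw [norm_radialMap hz, Real.sq_sqrt (by positivity)]
  have hlow : ∀ z : CSpace n, z ≠ 0 → lam < ‖radialMap n lam z‖ := fun z hz => by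
    have h0 : 0 < ‖z‖ := norm_pos_iff.2 hz
    rw [norm_radialMap hz]
    exact Real.lt_sqrt_of_sq_lt (by nlinarith)
  have hshell := isSymplecticSubmanifold_node (n := n)
    (A := Metric.ball 0 (Real.sqrt (lam ^ 2 + δ ^ 2)) \ Metric.closedBall 0 lam)
    (Metric.isOpen_ball.sdiff Metric.isClosed_closedBall)
    fun h => h.2 (Metric.mem_closedBall_self hlam.le)
  have hopen := isSymplectomorphismOn_radialMap (n := n) hlam (A := Metric.ball 0 δ)
    (B := Metric.ball 0 (Real.sqrt (lam ^ 2 + δ ^ 2)) \ Metric.closedBall 0 lam)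
    -- Since `|F z|² = |z|² + λ²`, the bound `|z| < δ` becomes the outer radius of the shell, and
    -- the inner bound `|F z| > λ` is automatic for `z ≠ 0`.
    (fun z hz => by
      rw [Set.mem_sdiff, mem_ball_zero_iff, mem_ball_zero_iff, mem_closedBall_zero_iff, not_le,
        Real.lt_sqrt (norm_nonneg _), hmap z hz, add_comm (lam ^ 2), add_lt_add_iff_right,
        sq_lt_sq₀ (norm_nonneg _) hδ.le, and_iff_left (hlow z hz)])
    (fun w hw => not_le.1 fun h => hw.2 (mem_closedBall_zero_iff.2 h))
  have hclosed := isSymplectomorphismOn_radialMap (n := n) hlam (A := Metric.closedBall 0 δ)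
    (B := Metric.closedBall 0 (Real.sqrt (lam ^ 2 + δ ^ 2)) \ Metric.closedBall 0 lam)
    (fun z hz => by
      rw [Set.mem_sdiff, mem_closedBall_zero_iff, mem_closedBall_zero_iff, mem_closedBall_zero_iff,
        not_le, Real.le_sqrt (norm_nonneg _) (by positivity), hmap z hz, add_comm (lam ^ 2),
        add_le_add_iff_right, sq_le_sq₀ (norm_nonneg _) hδ.le, and_iff_left (hlow z hz)])
    (fun w hw => not_le.1 fun h => hw.2 (mem_closedBall_zero_iff.2 h))
  exact ⟨hopen.isSymplecticSubmanifold hshell, hshell, hopen, hclosed⟩
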